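/- Let $n\ge d\ge 1$ and let $\mathcal A=V(\ell_0\cdots\ell_n)\subseteq\mathbb C^d$ be an essential, non-central arrangement of $n+1$ affine hyperplanes, where $\ell_i(x)=b_i+\sum_{k=1}^d A_{ik}x_k$ with $A\in\mathbb C^{(n+1)\times d}$, $b\in\mathbb C^{n+1}$; that is, all rows of $A$ are non-zero and $[\,b\mid A\,]$ has rank $d+1$. Let $X=\mathbb C^d\setminus\mathcal A$, $\mathbb T=\mathbb P^n\setminus V(u_0\cdots u_n)$ and $D=\mathbb P^n\setminus\bigcup_{i<j}V(u_i,u_j)$. All inclusions below are inclusions of closed subschemes. For a morphism of schemes $g\colon V\to W$ locally of finite type, let $\mathrm{Ram}(g)\subseteq V$ be the closed subscheme defined by the $0$-th Fitting ideal of the sheaf of relative differentials $\Omega_g$ (for smooth varieties $V,W$ of equal dimension it is locally defined by the Jacobian determinant of $g$), and let $\mathrm{Branch}(g)\subseteq W$ be the closed scheme-theoretic image of $\mathrm{Ram}(g)$ under $g$. Let $\mathcal L_X^\circ=\{(u,x)\mid A^{\mathsf T}\,\mathrm{diag}(1/\ell_0(x),\dots,1/\ell_n(x))\,u=0\}\subseteq\mathbb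 P^n\times X$, with projection $f\colon\mathcal L_X^\circ\to\mathbb P^n$. The *logarithmic discriminant* is $\nabla_{\log}(X)=\mathrm{Branch}(f)$. Let $\gamma\colon X\hookrightarrow\mathbb P^n$, $x\mapsto(1/\ell_0(x):\dots:1/\ell_n(x))$, let $\mathbb G(n-d,\mathbb P^n)$ be the Grassmannian of $(n-d)$-dimensional linear subspaces of $\mathbb P^n$, let $\mathcal I^\circ=\{(\Lambda,y)\mid y\in\Lambda\cap\mathrm{im}(\gamma)\}$ with projection $\mathrm{pr}_\Lambda\colon\mathcal I^\circ\to\mathbb G(n-d,\mathbb P^n)$, and let $\mathcal Z_1=\mathrm{Branch}(\mathrm{pr}_\Lambda)$. Let $\varphi\colon\mathbb P^n\dashrightarrow\mathbb G(n-d,\mathbb P^n)$ be the rational map given on $\mathbb T$ by $u\mapsto\mathrm{Ker}(A^{\mathsf T}\mathrm{diag}(u_0,\dots,u_n))$. The *Hurwitz discriminant* $\nabla_{\mathrm{Hu}}(X)$ is the scheme-theoretic closure in $\mathbb P^n$ of the pullback of $\mathcal Z_1$ along $\varphi$ on its maximal domain of definition. Then: 1. $\nabla_{\log}(X)\cap\mathbb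 T\subseteq\nabla_{\mathrm{Hu}}(X)\cap\mathbb T$ as schemes. 2. If for every $i=0,\dots,n$ the $n\times d$ submatrix $A^i$ of $A$, obtained by deleting the $i$-th row, has full rank $d$, then $\nabla_{\log}(X)\cap D\subseteq\nabla_{\mathrm{Hu}}(X)\cap D$ as schemes. 3. For every cartesian square of schemes formed by $g\colon V\to W$, $\psi\colon W'\to W$ and the projections $g'\colon V'\to W'$, $\psi'\colon V'\to V$ of $V'=V\times_W W'$, with $g$ locally of finite type (in particular for every cartesian square of smooth varieties), $\mathrm{Ram}(g')=\psi'^{-1}(\mathrm{Ram}(g))$ and $\mathrm{Branch}(g')\subseteq\psi^{-1}(\mathrm{Branch}(g))$ as closed subschemes of $V'$ and $W'$. -/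

import Mathlib

open AlgebraicGeometry CategoryTheory CategoryTheory.Limits MvPolynomial TopologicalSpace

noncomputable section

namespace LogDisc

/-! ### Fitting ideals, ramification schemes and branch schemes -/

/-- The zeroth Fitting ideal of a finitely generated module `M` over a commutative ring `S`:
the ideal generated by the determinants of all square matrices whose rows are relations
among a finite generating family of `M`. -/
def fittingIdeal (S : Type*) [CommRing S] (M : Type*) [AddCommGroup M] [Module S M] : Ideal S :=
  Ideal.span {x | ∃ (m : ℕ) (g : Fin m → M) (a : Matrix (Fin m) (Fin m) S),
    Submodule.span S (Set.range g) = ⊤ ∧ (∀ i, ∑ j, a i j • g j = 0) ∧ x = a.det}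

/-- The ramification ideal of a ring homomorphism `R → S`: the zeroth Fitting ideal of the module
of relative differentials `Ω[S⁄R]`, i.e. of the cokernel of `S ⊗ Ω_R → Ω_S`.
If `R`, `S` are smooth of the same dimension over a field, it is locally generated by the
determinant of the Jacobian matrix of `Spec S → Spec R`. -/
def ramificationIdeal {R S : Type*} [CommRing R] [CommRing S] (φ : R →+* S) : Ideal S :=
  letI := φ.toAlgebra
  fittingIdeal S (Ω[S⁄R])

/-- The zeroth Fitting ideal of the cokernel of a square matrix is generated by its determinant. -/
lemma fittingIdeal_eq_span_det {S M : Type*} [CommRing S] [AddCommGroup M] [Module S M] {n : ℕ}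
    (h : Fin n → M) (hh : Submodule.span S (Set.range h) = ⊤) (J : Matrix (Fin n) (Fin n) S)
    (hJ : ∀ s : Fin n → S, ∑ j, s j • h j = 0 ↔ ∃ x : Fin n → S, Matrix.vecMul x J = s) :
    fittingIdeal S M = Ideal.span {J.det} := by
  apply le_antisymm
  · rw [fittingIdeal, Ideal.span_le]
    rintro _ ⟨m, g, a, hg, ha, rfl⟩
    have hC (j : Fin m) : ∃ c : Fin n → S, ∑ i, c i • h i = g j := by
      have : g j ∈ Submodule.span S (Set.range h) := hh ▸ Submodule.mem_top
      exact (Submodule.mem_span_range_iff_exists_fun S).mp this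
    have hD (i : Fin n) : ∃ c : Fin m → S, ∑ j, c j • g j = h i := by
      have : h i ∈ Submodule.span S (Set.range g) := hg ▸ Submodule.mem_top
      exact (Submodule.mem_span_range_iff_exists_fun S).mp this
    choose Cm hC using hC
    choose Dm hD using hD
    let C : Matrix (Fin m) (Fin n) S := Matrix.of Cm
    let D : Matrix (Fin n) (Fin m) S := Matrix.of Dm
    have sumC (r : Fin m → S) : ∑ i, (Matrix.vecMul r C) i • h i = ∑ j, r j • g j := by
      simp only [Matrix.vecMul, dotProduct, Finset.sum_smul, ← hC, Finset.smul_sum, C,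
        Matrix.of_apply, mul_smul]
      exact Finset.sum_comm
    have hX (i : Fin m) : ∃ x : Fin n → S, Matrix.vecMul x J = (a * C) i := by
      rw [← hJ]
      exact (sumC (a i)).trans (ha i)
    have hY (i : Fin n) : ∃ x : Fin n → S, Matrix.vecMul x J = (D * C - 1 : Matrix (Fin n) (Fin n) S) i := by
      rw [← hJ]
      have : ∑ j, (D * C) i j • h j = h i := (sumC (D i)).trans (hD i)
      simp [sub_smul, this, Matrix.one_apply, Finset.sum_sub_distrib]
    choose Xm hX using hX
    choose Ym hY using hY
    let X : Matrix (Fin m) (Fin n) S := Matrix.of Xm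
    let Y : Matrix (Fin n) (Fin n) S := Matrix.of Ym
    have hX' : X * J = a * C := by
      ext i j
      exact congrFun (hX i) j
    have hY' : Y * J = D * C - 1 := by
      ext i j
      exact congrFun (hY i) j
    have key : Matrix.fromBlocks a 0 D (-1) * Matrix.fromBlocks 1 C 0 1 =
        Matrix.fromBlocks a X D Y * Matrix.fromBlocks 1 0 0 J := by
      simp [Matrix.fromBlocks_multiply, hX', hY', sub_eq_add_neg]
    have hdet := congrArg Matrix.det key
    simp only [Matrix.det_mul, Matrix.det_fromBlocks_zero₁₂, Matrix.det_fromBlocks_zero₂₁,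
      Matrix.det_one, mul_one, one_mul, Matrix.det_neg] at hdet
    rw [SetLike.mem_coe, Ideal.mem_span_singleton]
    have hu : IsUnit ((-1 : S) ^ Fintype.card (Fin n)) := (isUnit_one.neg).pow _
    rw [← hu.dvd_mul_right, hdet]
    exact dvd_mul_left _ _
  · rw [Ideal.span_singleton_le_iff_mem]
    refine Ideal.subset_span ⟨n, h, J, hh, fun i => ?_, rfl⟩
    exact (hJ (J i)).mpr ⟨Pi.single i 1, by simp; rfl⟩

/-- The ramification ideal of a homomorphism `R → S` of `k`-algebras, whose modules of
differentials are free of the same rank, is generated by the determinant of the Jacobian matrix,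
i.e. of the matrix of `S ⊗ Ω_R → Ω_S`. -/
lemma ramificationIdeal_eq_span_det_jacobian {k R S : Type*} [CommRing k] [CommRing R] [CommRing S]
    [Algebra k R] [Algebra k S] [inst : Algebra R S] [IsScalarTower k R S] {n : ℕ}
    (e : Module.Basis (Fin n) R (Ω[R⁄k])) (e' : Module.Basis (Fin n) S (Ω[S⁄k])) :
    ramificationIdeal (algebraMap R S) = Ideal.span {(Matrix.of fun i j : Fin n =>
      e'.repr (KaehlerDifferential.map k k R S (e i)) j).det} := by
  have halg : ∀ i j : Algebra R S, i = j → (letI := i; fittingIdeal S (Ω[S⁄R])) =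
      (letI := j; fittingIdeal S (Ω[S⁄R])) := by
    intro i j h
    cases h
    rfl
  refine (halg (algebraMap R S).toAlgebra inst (Algebra.algebra_ext _ _ fun _ => rfl)).trans ?_
  have hsurj : Function.Surjective (KaehlerDifferential.map k R S S) :=
    KaehlerDifferential.map_surjective k R S
  have hlin (s : Fin n → S) : ∑ j, s j • KaehlerDifferential.map k R S S (e' j) =
      KaehlerDifferential.map k R S S (e'.equivFun.symm s) := by
    simp [Module.Basis.equivFun_symm_apply, map_sum]
  refine fittingIdeal_eq_span_det (S := S) (M := Ω[S⁄R])
    (fun i => KaehlerDifferential.map k R S S (e' i)) ?_ _ fun s => ?_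
  · rw [Set.range_comp' (KaehlerDifferential.map k R S S) e', Submodule.span_image, e'.span_eq,
      Submodule.map_top, LinearMap.range_eq_top.mpr hsurj]
  · rw [hlin, (KaehlerDifferential.exact_mapBaseChange_map k R S) _]
    have key (x : Fin n → S) : KaehlerDifferential.mapBaseChange k R S
        ((e.baseChange S).equivFun.symm x) = e'.equivFun.symm (Matrix.vecMul x
          (Matrix.of fun i j : Fin n => e'.repr (KaehlerDifferential.map k k R S (e i)) j)) := by
      rw [LinearEquiv.eq_symm_apply, Module.Basis.equivFun_symm_apply, map_sum, map_sum]
      ext j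
      simp [Matrix.vecMul, dotProduct, Module.Basis.baseChange_apply, Finset.sum_apply]
    constructor
    · rintro ⟨t, ht⟩
      refine ⟨(e.baseChange S).equivFun t, e'.equivFun.symm.injective ?_⟩
      rw [← key, LinearEquiv.symm_apply_apply, ht]
    · rintro ⟨x, rfl⟩
      exact ⟨_, key x⟩

/-- The ideal sheaf of the ramification scheme `Ram(f)` of a morphism `f : X ⟶ Y`: the (largest)
quasi-coherent ideal sheaf which, on each affine open `U` of `X` that is mapped into an affine open
`V` of `Y`, is (contained in) the zeroth Fitting ideal of `Ω[Γ(X, U)⁄Γ(Y, V)]`. -/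
def ram {X Y : Scheme.{0}} (f : X ⟶ Y) : X.IdealSheafData :=
  Scheme.IdealSheafData.ofIdeals fun U =>
    ⨅ (V : Y.affineOpens) (e : U.1 ≤ f ⁻¹ᵁ V.1), ramificationIdeal (f.appLE V.1 U.1 e).hom

/-- The ideal sheaf of the branch scheme `Branch(f)`: the scheme-theoretic image of `Ram(f)`
under `f : X ⟶ Y`. -/
def branch {X Y : Scheme.{0}} (f : X ⟶ Y) : Y.IdealSheafData :=
  (ram f).map f

/-! ### Projective schemes over the complex numbers -/

/-- The base scheme `Spec ℂ`. -/
abbrev SpecC : Scheme.{0} := Spec (.of ℂ)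

section Proj

variable {A : Type} [CommRing A] [Algebra ℂ A] (𝒜 : ℕ → Submodule ℂ A) [GradedAlgebra 𝒜]

/-- The structure morphism `Proj 𝒜 ⟶ Spec ℂ` of a graded `ℂ`-algebra. -/
def projToSpec : Proj 𝒜 ⟶ SpecC :=
  Proj.toSpecZero 𝒜 ≫ Spec.map (CommRingCat.ofHom (algebraMap ℂ (𝒜 0)))

end Proj

/-- The standard grading of the homogeneous coordinate ring `ℂ[u₀, …, uₙ]`. -/
abbrev coordGrading (n : ℕ) : ℕ → Submodule ℂ (MvPolynomial (Fin (n + 1)) ℂ) :=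
  homogeneousSubmodule (Fin (n + 1)) ℂ

instance coordGradedAlgebra (n : ℕ) : GradedAlgebra (coordGrading n) :=
  MvPolynomial.gradedAlgebra

/-- Projective space `ℙⁿ` over `ℂ`. -/
abbrev PP (n : ℕ) : Scheme.{0} := Proj (coordGrading n)

instance isReduced_PP (n : ℕ) : IsReduced (PP n) := by
  refine @isReduced_of_isReduced_stalk _ fun x => ?_
  have e := (Proj.stalkIso (coordGrading n) x).commRingCatIsoToRingEquiv
  have := x.isPrime
  have hx : x.asHomogeneousIdeal.toIdeal.primeCompl ≤
      nonZeroDivisors (MvPolynomial (Fin (n + 1)) ℂ) :=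
    Ideal.primeCompl_le_nonZeroDivisors _
  have : IsDomain (Localization x.asHomogeneousIdeal.toIdeal.primeCompl) :=
    IsLocalization.isDomain_localization hx
  have : _root_.IsReduced
      (HomogeneousLocalization.AtPrime (coordGrading n) x.asHomogeneousIdeal.toIdeal) :=
    isReduced_of_injective
      (algebraMap _ (Localization x.asHomogeneousIdeal.toIdeal.primeCompl))
      (HomogeneousLocalization.val_injective _)
  exact isReduced_of_injective e.toRingHom e.injective

/-- The torus `𝕋 = ℙⁿ ∖ V(u₀ ⋯ uₙ)`. -/
def torus (n : ℕ) : (PP n).Opens :=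
  Proj.basicOpen (coordGrading n) (∏ i, X i)

/-- The open `D = ℙⁿ ∖ ⋃_{i < j} V(uᵢ, uⱼ)`. -/
def domD (n : ℕ) : (PP n).Opens :=
  ⨅ (i : Fin (n + 1)) (j : Fin (n + 1)) (_ : i < j),
    Proj.basicOpen (coordGrading n) (X i) ⊔ Proj.basicOpen (coordGrading n) (X j)

lemma dense_torus (n : ℕ) : Dense (torus n : Set (PP n)) := by
  let η : PP n := ⟨⊥, Ideal.isPrime_bot, fun h => X_ne_zero (R := ℂ) (0 : Fin (n + 1)) <| by
    have : (X 0 : MvPolynomial (Fin (n + 1)) ℂ) ∈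
        HomogeneousIdeal.irrelevant (coordGrading n) := by
      rw [HomogeneousIdeal.mem_irrelevant_iff, GradedRing.proj_apply]
      exact DirectSum.decompose_of_mem_ne _ (isHomogeneous_X ℂ 0) one_ne_zero
    exact Ideal.mem_bot.mp (h this)⟩
  have hη (f : MvPolynomial (Fin (n + 1)) ℂ) (hf : f ≠ 0) :
      η ∈ Proj.basicOpen (coordGrading n) f := by
    rw [Proj.mem_basicOpen]
    exact fun h => hf (Ideal.mem_bot.mp h)
  have hb := Proj.isBasis_basicOpen (coordGrading n)
  rw [hb.dense_iff]
  rintro _ ⟨_, ⟨f, rfl⟩, rfl⟩ ⟨x, hx⟩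
  refine ⟨η, hη f ?_, hη _ ?_⟩
  · rintro rfl
    simp at hx
  · exact Finset.prod_ne_zero_iff.mpr fun i _ => X_ne_zero i

/-! ### The Grassmannian -/

/-- The `d × d` minor, with columns `c`, of the generic `d × (n + 1)` matrix. -/
def minor (n d : ℕ) (c : Fin d → Fin (n + 1)) : MvPolynomial (Fin d × Fin (n + 1)) ℂ :=
  (Matrix.of fun k l : Fin d => (X (k, c l) : MvPolynomial (Fin d × Fin (n + 1)) ℂ)).det

/-- The Plücker algebra: the algebra generated by the maximal minors of the generic
`d × (n + 1)` matrix. -/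
def pluckerAlgebra (n d : ℕ) : Subalgebra ℂ (MvPolynomial (Fin d × Fin (n + 1)) ℂ) :=
  Algebra.adjoin ℂ (Set.range (minor n d))

/-- The grading of the Plücker algebra in which the minors have degree one. -/
def pluckerGrading (n d : ℕ) (k : ℕ) : Submodule ℂ (pluckerAlgebra n d) :=
  (homogeneousSubmodule (Fin d × Fin (n + 1)) ℂ (d * k)).comap (pluckerAlgebra n d).val.toLinearMap

/-- A minor as an element of the Plücker algebra. -/
def pluckerCoord (n d : ℕ) (c : Fin d → Fin (n + 1)) : pluckerAlgebra n d :=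
  ⟨minor n d c, Algebra.subset_adjoin ⟨c, rfl⟩⟩

lemma minor_isHomogeneous (n d : ℕ) (c : Fin d → Fin (n + 1)) : (minor n d c).IsHomogeneous d := by
  rw [minor, Matrix.det_apply]
  refine IsHomogeneous.sum _ _ _ fun σ _ => ?_
  have h : (∏ i, (X (σ i, c i) : MvPolynomial (Fin d × Fin (n + 1)) ℂ)).IsHomogeneous d := by
    simpa using IsHomogeneous.prod (R := ℂ) Finset.univ
      (fun i : Fin d => X (σ i, c i)) (fun _ => 1) (fun i _ => isHomogeneous_X ℂ _)
  exact (homogeneousSubmodule _ ℂ d).smul_of_tower_mem (Equiv.Perm.sign σ) h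

lemma pluckerCoord_mem (n d : ℕ) (c : Fin d → Fin (n + 1)) :
    pluckerCoord n d c ∈ pluckerGrading n d 1 := by
  simpa [pluckerGrading, pluckerCoord] using minor_isHomogeneous n d c

instance pluckerGradedMonoid (n d : ℕ) : SetLike.GradedMonoid (pluckerGrading n d) where
  one_mem := by
    change (1 : MvPolynomial (Fin d × Fin (n + 1)) ℂ) ∈ homogeneousSubmodule _ _ (d * 0)
    rw [mul_zero]
    exact isHomogeneous_one (Fin d × Fin (n + 1)) ℂ
  mul_mem i j x y hx hy := by
    simp only [pluckerGrading, Submodule.mem_comap, mem_homogeneousSubmodule] at hx hy ⊢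
    rw [mul_add]
    simpa using IsHomogeneous.mul hx hy

lemma pluckerGrading_isInternal (n d : ℕ) [NeZero d] :
    DirectSum.IsInternal (pluckerGrading n d) := by
  refine DirectSum.isInternal_submodule_of_iSupIndep_of_iSup_eq_top ?_ ?_
  · let := MvPolynomial.decomposition (σ := Fin d × Fin (n + 1)) (R := ℂ)
    have h := (DirectSum.Decomposition.isInternal
      (homogeneousSubmodule (Fin d × Fin (n + 1)) ℂ)).submodule_iSupIndep
    have h' := h.comp (f := fun k : ℕ => d * k) (fun a b hab => Nat.eq_of_mul_eq_mul_left
      (Nat.pos_of_ne_zero (NeZero.ne d)) hab)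
    rw [iSupIndep_def] at h' ⊢
    intro i
    rw [Submodule.disjoint_def]
    intro x hx hx'
    have key := Submodule.mem_map_of_mem (f := (pluckerAlgebra n d).val.toLinearMap) hx'
    simp only [Submodule.map_iSup] at key
    have := (Submodule.disjoint_def.mp (h' i)) x hx
      ((iSup₂_mono fun j _ => Submodule.map_comap_le _ _) key)
    exact Subtype.ext this
  · rw [eq_top_iff]
    rintro ⟨x, hx⟩ -
    induction hx using Algebra.adjoin_induction with
    | mem x hx =>
      obtain ⟨c, rfl⟩ := hx
      exact Submodule.mem_iSup_of_mem 1 (pluckerCoord_mem n d c)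
    | algebraMap r =>
      refine Submodule.mem_iSup_of_mem 0 ?_
      change (C r : MvPolynomial (Fin d × Fin (n + 1)) ℂ) ∈ homogeneousSubmodule _ _ (d * 0)
      rw [mul_zero]
      exact isHomogeneous_C (Fin d × Fin (n + 1)) r
    | add x y hx hy h₁ h₂ => exact add_mem h₁ h₂
    | mul x y hx hy h₁ h₂ =>
      have := Submodule.mul_mem_mul h₁ h₂
      rw [Submodule.iSup_mul] at this
      refine (iSup_le fun i => ?_ : _ ≤ iSup (pluckerGrading n d)) this
      rw [Submodule.mul_iSup]
      refine iSup_le fun j => ?_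
      refine le_trans ?_ (le_iSup _ (i + j))
      rw [Submodule.mul_le]
      exact fun a ha b hb => SetLike.mul_mem_graded ha hb

instance pluckerGradedAlgebra (n d : ℕ) [NeZero d] : GradedAlgebra (pluckerGrading n d) :=
  DirectSum.IsInternal.gradedAlgebra (pluckerGrading_isInternal n d)

/-- The Grassmannian `𝔾(n - d, ℙⁿ)` of `(n - d)`-dimensional linear subspaces of `ℙⁿ`, in its
Plücker embedding.  The subspace `Λ = ker B`, for a `d × (n + 1)` matrix `B` of rank `d`, is the
point whose (dual) Plücker coordinates are the maximal minors of `B`. -/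
abbrev Gr (n d : ℕ) [NeZero d] : Scheme.{0} := Proj (pluckerGrading n d)

/-! ### Linear incidence schemes in products with an affine scheme -/

section Incidence

variable {A : Type} [CommRing A] [Algebra ℂ A] (𝒜 : ℕ → Submodule ℂ A) [GradedAlgebra 𝒜]
variable (R : Type) [CommRing R] [Algebra ℂ R]

/-- The structure morphism `Spec R ⟶ Spec ℂ` of a `ℂ`-algebra. -/
def specToSpec : Spec (.of R) ⟶ SpecC :=
  Spec.map (CommRingCat.ofHom (algebraMap ℂ R))

/-- The product `Proj 𝒜 × Spec R` over `ℂ`. -/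
abbrev ProjProd : Scheme.{0} := pullback (projToSpec 𝒜) (specToSpec R)

/-- The projection `Proj 𝒜 × Spec R ⟶ Proj 𝒜`. -/
abbrev projFst : ProjProd 𝒜 R ⟶ Proj 𝒜 := pullback.fst (projToSpec 𝒜) (specToSpec R)

/-- The projection `Proj 𝒜 × Spec R ⟶ Spec R`. -/
abbrev projSnd : ProjProd 𝒜 R ⟶ Spec (.of R) := pullback.snd (projToSpec 𝒜) (specToSpec R)

variable {𝒜}

instance isAffineHom_projFst : IsAffineHom (projFst 𝒜 R) := by
  have h : IsAffineHom (specToSpec R) := by unfold specToSpec; infer_instance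
  have : MorphismProperty.IsStableUnderBaseChange @IsAffineHom.{0} := inferInstance
  exact this.of_isPullback (IsPullback.of_hasPullback (projToSpec 𝒜) (specToSpec R)).flip h

/-- The affine open `D₊(f) × Spec R` of `Proj 𝒜 × Spec R`. -/
def chart {f : A} (hf : f ∈ 𝒜 1) : (ProjProd 𝒜 R).affineOpens :=
  ⟨projFst 𝒜 R ⁻¹ᵁ Proj.basicOpen 𝒜 f,
    (Proj.isAffineOpen_basicOpen 𝒜 f hf one_pos).preimage (projFst 𝒜 R)⟩

/-- Pullback of functions from `D₊(f)` to `D₊(f) × Spec R`. -/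
def pullFst {f : A} (hf : f ∈ 𝒜 1) :
    HomogeneousLocalization.Away 𝒜 f →+* Γ(ProjProd 𝒜 R, (chart R hf).1) :=
  (Proj.awayToSection 𝒜 f ≫ (projFst 𝒜 R).app (Proj.basicOpen 𝒜 f)).hom

/-- Pullback of functions from `Spec R` to `D₊(f) × Spec R`. -/
def pullSnd {f : A} (hf : f ∈ 𝒜 1) : R →+* Γ(ProjProd 𝒜 R, (chart R hf).1) :=
  ((Scheme.ΓSpecIso (.of R)).inv ≫ (projSnd 𝒜 R).appLE ⊤ (chart R hf).1 le_top).hom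

/-- The quotient `x / f`, as a function on `D₊(f)`, of two elements of degree one. -/
def quot {f x : A} (hf : f ∈ 𝒜 1) (hx : x ∈ 𝒜 1) : HomogeneousLocalization.Away 𝒜 f :=
  HomogeneousLocalization.Away.mk 𝒜 hf 1 x hx

/-- The ideal sheaf of the closed subscheme of `Proj 𝒜 × Spec R` which on `D₊(f i) × Spec R` is
defined by the linear equations `∑ j, (M i k j / f i) * y j = 0` for all `k`: the smallest ideal
sheaf containing the left-hand sides. -/
def incidence {ι κ τ : Type} [Fintype τ] {f : ι → A} (hf : ∀ i, f i ∈ 𝒜 1)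
    {M : ι → κ → τ → A} (hM : ∀ i k j, M i k j ∈ 𝒜 1) (y : τ → R) :
    (ProjProd 𝒜 R).IdealSheafData :=
  sInf {I | ∀ i k, ∑ j, pullFst R (hf i) (quot (hf i) (hM i k j)) * pullSnd R (hf i) (y j) ∈
    I.ideal (chart R (hf i))}

end Incidence

section Away

variable {A : Type} [CommRing A] [Algebra ℂ A] {𝒜 : ℕ → Submodule ℂ A} [GradedAlgebra 𝒜]

lemma away_mul_eq_one {m : ℕ} {f a b : A} (hf : f ∈ 𝒜 m) (ha : a ∈ 𝒜 (1 • m)) (hb : b ∈ 𝒜 (1 • m))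
    (h : f * f = a * b) : HomogeneousLocalization.Away.mk 𝒜 hf 1 a ha *
      HomogeneousLocalization.Away.mk 𝒜 hf 1 b hb = 1 := by
  apply HomogeneousLocalization.val_injective
  rw [HomogeneousLocalization.val_mul, HomogeneousLocalization.val_one,
    HomogeneousLocalization.Away.val_mk, HomogeneousLocalization.Away.val_mk,
    Localization.mk_mul, ← h, Localization.mk_eq_mk', IsLocalization.mk'_eq_iff_eq_mul]
  simp

lemma away_const_mul {m : ℕ} {f a : A} (hf : f ∈ 𝒜 m) (ha : a ∈ 𝒜 (1 • m)) (r : ℂ) :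
    HomogeneousLocalization.fromZeroRingHom 𝒜 (Submonoid.powers f) (algebraMap ℂ (𝒜 0) r) *
      HomogeneousLocalization.Away.mk 𝒜 hf 1 a ha =
    HomogeneousLocalization.Away.mk 𝒜 hf 1 (algebraMap ℂ A r * a)
      (by rw [← Algebra.smul_def]; exact Submodule.smul_mem _ _ ha) := by
  apply HomogeneousLocalization.val_injective
  have : (HomogeneousLocalization.fromZeroRingHom 𝒜 (Submonoid.powers f)
      (algebraMap ℂ (𝒜 0) r)).val = Localization.mk (algebraMap ℂ A r) 1 := rfl
  rw [HomogeneousLocalization.val_mul, HomogeneousLocalization.Away.val_mk,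
    HomogeneousLocalization.Away.val_mk, this, Localization.mk_mul, one_mul]

end Away

/-! ### Hyperplane arrangements and the two discriminants -/

/-- An essential non-central arrangement of `n + 1` affine hyperplanes in `ℂᵈ`, given by the
affine linear forms `ℓᵢ(x) = bᵢ + ∑ₖ Aᵢₖ xₖ`. Essentiality and non-centrality together mean that
the matrix `Lᵀ = [b | A]` has full rank `d + 1`. -/
structure Arrangement (n d : ℕ) where
  /-- The linear parts of the affine linear forms. -/
  A : Matrix (Fin (n + 1)) (Fin d) ℂ
  /-- The constant terms of the affine linear forms. -/
  b : Fin (n + 1) → ℂ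
  row_ne_zero : ∀ i, A i ≠ 0
  rank_eq : (Matrix.of fun i => (Fin.cons (b i) (A i) : Fin (d + 1) → ℂ)).rank = d + 1

namespace Arrangement

variable {n d : ℕ} (𝓐 : Arrangement n d)

/-- The affine linear form `ℓᵢ`. -/
def ell (i : Fin (n + 1)) : MvPolynomial (Fin d) ℂ :=
  C (𝓐.b i) + ∑ k, C (𝓐.A i k) * X k

/-- The coordinate ring of the complement `X = ℂᵈ ∖ V(ℓ₀ ⋯ ℓₙ)`. -/
abbrev coordRing : Type := Localization.Away (∏ i, 𝓐.ell i)

lemma isUnit_ell (i : Fin (n + 1)) : IsUnit (algebraMap _ 𝓐.coordRing (𝓐.ell i)) :=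
  isUnit_of_dvd_unit (map_dvd _ (Finset.dvd_prod_of_mem _ (Finset.mem_univ i)))
    (IsLocalization.Away.algebraMap_isUnit (∏ i, 𝓐.ell i))

/-- The function `1 / ℓᵢ` on the complement; the point `x` of the complement corresponds to the
point `γ(x) = (1 / ℓ₀(x) : ⋯ : 1 / ℓₙ(x))` of the reciprocal linear space. -/
def recip (i : Fin (n + 1)) : 𝓐.coordRing :=
  ((𝓐.isUnit_ell i).unit⁻¹ : 𝓐.coordRingˣ)

/-- The ideal sheaf of the likelihood correspondence
`{(u, x) | Aᵀ diag(1/ℓ₀(x), …, 1/ℓₙ(x)) u = 0} ⊆ ℙⁿ × X`. On the chart `uᵢ ≠ 0` the equations are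
`∑ⱼ Aⱼₖ (uⱼ / uᵢ) (1 / ℓⱼ) = 0`. -/
def likelihoodIdeal : (ProjProd (coordGrading n) 𝓐.coordRing).IdealSheafData :=
  incidence 𝓐.coordRing (𝒜 := coordGrading n) (f := fun i : Fin (n + 1) => X i)
    (M := fun (_ : Fin (n + 1)) (k : Fin d) (j : Fin (n + 1)) => C (𝓐.A j k) * X j)
    (fun i => isHomogeneous_X ℂ i)
    (fun _ k j => isHomogeneous_C_mul_X (𝓐.A j k) j) 𝓐.recip

/-- The projection `f` of the likelihood correspondence to `ℙⁿ`. -/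
def likelihoodProj : 𝓐.likelihoodIdeal.subscheme ⟶ PP n :=
  𝓐.likelihoodIdeal.subschemeι ≫ projFst (coordGrading n) 𝓐.coordRing

/-- The ideal sheaf of the logarithmic discriminant `∇_log(X)`, the branch scheme of the
projection of the likelihood correspondence to `ℙⁿ`. -/
def nablaLog : (PP n).IdealSheafData :=
  branch 𝓐.likelihoodProj

lemma prod_X_mem (n : ℕ) : (∏ i, X i : MvPolynomial (Fin (n + 1)) ℂ) ∈ coordGrading n (n + 1) := by
  simpa using IsHomogeneous.prod (R := ℂ) Finset.univ (fun i : Fin (n + 1) => X i) (fun _ => 1)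
    (fun i _ => isHomogeneous_X ℂ i)

/-- The entry `Aⱼₖ uⱼ / u₀` of the matrix `Aᵀ diag(u) / u₀`, as a function on the torus. It is
written with denominator `u₀ ⋯ uₙ`. -/
def torusEntry (k : Fin d) (j : Fin (n + 1)) :
    HomogeneousLocalization.Away (coordGrading n) (∏ i, X i) :=
  HomogeneousLocalization.Away.mk (coordGrading n) (prod_X_mem n) 1
    (C (𝓐.A j k) * X j * ∏ i : Fin n, X i.succ) (by
      have h : (∏ i : Fin n, (X i.succ : MvPolynomial (Fin (n + 1)) ℂ)).IsHomogeneous n := by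
        simpa using IsHomogeneous.prod (R := ℂ) Finset.univ
          (fun i : Fin n => (X i.succ : MvPolynomial (Fin (n + 1)) ℂ)) (fun _ => 1)
          (fun i _ => isHomogeneous_X ℂ _)
      simpa [add_comm] using (isHomogeneous_C_mul_X (𝓐.A j k) j).mul h)

/-- The pullback of functions of the generic `d × (n + 1)` matrix under
`u ↦ Aᵀ diag(u) / u₀`, for `u` in the torus. -/
def torusEval : MvPolynomial (Fin d × Fin (n + 1)) ℂ →+* Γ((torus n).toScheme, ⊤) :=
  (torus n).topIso.inv.hom.comp ((Proj.awayToSection (coordGrading n) (∏ i, X i)).hom.comp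
    (eval₂Hom ((HomogeneousLocalization.fromZeroRingHom (coordGrading n) _).comp
      (algebraMap ℂ (coordGrading n 0))) fun p => 𝓐.torusEntry p.1 p.2))

/-- The entry `Aⱼₖ uⱼ / u₀` is a constant times a unit. -/
lemma torusEntry_eq (j : Fin (n + 1)) : ∃ t : HomogeneousLocalization.Away (coordGrading n)
    (∏ i, X i), IsUnit t ∧ ∀ k, 𝓐.torusEntry k j =
      HomogeneousLocalization.fromZeroRingHom (coordGrading n) _
        (algebraMap ℂ (coordGrading n 0) (𝓐.A j k)) * t := by
  have h : (∏ i : Fin n, (X i.succ : MvPolynomial (Fin (n + 1)) ℂ)).IsHomogeneous n := by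
    simpa using IsHomogeneous.prod (R := ℂ) Finset.univ
      (fun i : Fin n => (X i.succ : MvPolynomial (Fin (n + 1)) ℂ)) (fun _ => 1)
      (fun i _ => isHomogeneous_X ℂ _)
  have h' : (∏ i ∈ Finset.univ.erase j, (X i : MvPolynomial (Fin (n + 1)) ℂ)).IsHomogeneous n := by
    simpa using IsHomogeneous.prod (R := ℂ) (Finset.univ.erase j)
      (fun i => (X i : MvPolynomial (Fin (n + 1)) ℂ)) (fun _ => 1)
      (fun i _ => isHomogeneous_X ℂ _)
  refine ⟨HomogeneousLocalization.Away.mk (coordGrading n) (prod_X_mem n) 1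
    (X j * ∏ i : Fin n, X i.succ) (by simpa [add_comm] using (isHomogeneous_X ℂ j).mul h), ?_, ?_⟩
  · refine IsUnit.of_mul_eq_one (HomogeneousLocalization.Away.mk (coordGrading n)
      (prod_X_mem n) 1 (X 0 * ∏ i ∈ Finset.univ.erase j, X i)
      (by simpa [add_comm] using (isHomogeneous_X ℂ (0 : Fin (n + 1))).mul h')) ?_
    apply away_mul_eq_one
    nth_rw 1 [Fin.prod_univ_succ]
    rw [← Finset.mul_prod_erase Finset.univ _ (Finset.mem_univ j)]
    ring
  · intro k
    rw [away_const_mul, torusEntry]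
    congr 1
    simp only [algebraMap_eq, mul_assoc]

lemma exists_det_ne_zero : ∃ c : Fin d → Fin (n + 1), (𝓐.A.submatrix c id).det ≠ 0 := by
  have hL := 𝓐.rank_eq
  rw [Matrix.rank] at hL
  set L := (Matrix.of fun i => (Fin.cons (𝓐.b i) (𝓐.A i) : Fin (d + 1) → ℂ)) with hLdef
  have hinj : Function.Injective L.mulVecLin := by
    rw [← LinearMap.ker_eq_bot, ← Submodule.finrank_eq_zero]
    have := L.mulVecLin.finrank_range_add_finrank_ker
    simp only [Module.finrank_fintype_fun_eq_card, Fintype.card_fin] at this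
    omega
  have hinjA : Function.Injective 𝓐.A.mulVecLin := by
    rw [← LinearMap.ker_eq_bot, LinearMap.ker_eq_bot']
    intro v hv
    have h0 : L.mulVecLin (Fin.cons 0 v) = 0 := by
      ext i
      have := congrFun hv i
      simpa [hLdef, Matrix.mulVec, dotProduct, Fin.sum_univ_succ] using this
    have h1 : (Fin.cons 0 v : Fin (d + 1) → ℂ) = 0 := hinj (by rw [h0, map_zero])
    ext k
    simpa using congrFun h1 k.succ
  have hrank : 𝓐.A.rank = d := by
    rw [Matrix.rank, LinearMap.finrank_range_of_inj hinjA]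
    simp
  rw [Matrix.rank_eq_finrank_span_row] at hrank
  obtain ⟨g, hg, -, hli⟩ := Submodule.exists_fun_fin_finrank_span_eq ℂ (Set.range 𝓐.A.row)
  choose c hc using hg
  refine ⟨fun k => c (Fin.cast hrank.symm k), ?_⟩
  have hli' : LinearIndependent ℂ (𝓐.A.submatrix (fun k => c (Fin.cast hrank.symm k)) id).row := by
    have e : (𝓐.A.submatrix (fun k => c (Fin.cast hrank.symm k)) id).row =
        g ∘ Fin.cast hrank.symm := by
      ext k l
      exact congrFun (hc _) l
    rw [e]
    exact hli.comp (Fin.cast hrank.symm) (Fin.cast_injective _)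
  rw [Matrix.linearIndependent_rows_iff_isUnit, Matrix.isUnit_iff_isUnit_det] at hli'
  exact hli'.ne_zero

variable [NeZero d]

/-- The ideal sheaf of the incidence `{(Λ, x) | γ(x) ∈ Λ}` in the product of the Grassmannian and
the complement `X ≅ im γ`. For `Λ = ker B`, on the chart where the minor `p_c = det B_c` with
columns `c` does not vanish, the equations are `B_c⁻¹ B γ(x) = 0`; by Cramer's rule, the entry of
`B_c⁻¹ B` in row `k` and column `j` is the quotient `p_{c'} / p_c`, where `c'` is obtained from `c`
by replacing its `k`-th member by `j`. -/
def hurwitzIdeal : (ProjProd (pluckerGrading n d) 𝓐.coordRing).IdealSheafData :=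
  incidence 𝓐.coordRing (𝒜 := pluckerGrading n d) (f := pluckerCoord n d)
    (M := fun (c : Fin d → Fin (n + 1)) (k : Fin d) (j : Fin (n + 1)) =>
      pluckerCoord n d (Function.update c k j))
    (pluckerCoord_mem n d) (fun _ _ _ => pluckerCoord_mem n d _) 𝓐.recip

/-- The projection `pr_Λ` of the incidence to the Grassmannian. -/
def hurwitzProj : 𝓐.hurwitzIdeal.subscheme ⟶ Gr n d :=
  𝓐.hurwitzIdeal.subschemeι ≫ projFst (pluckerGrading n d) 𝓐.coordRing

/-- The ideal sheaf of the first associated hypersurface of the reciprocal linear space: the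
branch scheme of `pr_Λ`. -/
def associatedHypersurface : (Gr n d).IdealSheafData :=
  branch 𝓐.hurwitzProj

lemma torusEval_irrelevant :
    (HomogeneousIdeal.irrelevant (pluckerGrading n d)).toIdeal.map
      (𝓐.torusEval.comp (pluckerAlgebra n d).val.toRingHom) = ⊤ := by
  obtain ⟨c, hc⟩ := 𝓐.exists_det_ne_zero
  choose t htu ht using torusEntry_eq 𝓐
  have hmem : pluckerCoord n d c ∈ (HomogeneousIdeal.irrelevant (pluckerGrading n d)).toIdeal := by
    change pluckerCoord n d c ∈ HomogeneousIdeal.irrelevant (pluckerGrading n d)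
    rw [HomogeneousIdeal.mem_irrelevant_iff, GradedRing.proj_apply]
    exact DirectSum.decompose_of_mem_ne _ (pluckerCoord_mem n d c) one_ne_zero
  refine Ideal.eq_top_of_isUnit_mem _ (Ideal.mem_map_of_mem _ hmem) ?_
  change IsUnit (𝓐.torusEval (minor n d c))
  refine IsUnit.map (torus n).topIso.inv.hom (IsUnit.map
    (Proj.awayToSection (coordGrading n) (∏ i, X i)).hom ?_)
  let z := (HomogeneousLocalization.fromZeroRingHom (coordGrading n)
    (Submonoid.powers (∏ i, X i : MvPolynomial (Fin (n + 1)) ℂ))).comp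
      (algebraMap ℂ (coordGrading n 0))
  have key : eval₂Hom z (fun p => 𝓐.torusEntry p.1 p.2) (minor n d c) =
      (∏ l, t (c l)) *
        z (𝓐.A.submatrix c id).det := by
    rw [minor, RingHom.map_det, ← Matrix.det_transpose (𝓐.A.submatrix c id), RingHom.map_det,
      ← Matrix.det_mul_row]
    congr 1
    ext k l
    simp [z, ht, mul_comm]
  rw [key]
  exact (IsUnit.prod_univ_iff.mpr fun l => htu (c l)).mul ((isUnit_iff_ne_zero.mpr hc).map z)

/-- The morphism `φ : 𝕋 ⟶ 𝔾(n - d, ℙⁿ)`, `u ↦ ker (Aᵀ diag(u))`. -/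
def torusMap : (torus n).toScheme ⟶ Gr n d :=
  Proj.fromOfGlobalSections (pluckerGrading n d)
    (𝓐.torusEval.comp (pluckerAlgebra n d).val.toRingHom) 𝓐.torusEval_irrelevant

/-- The rational map `φ : ℙⁿ ⇢ 𝔾(n - d, ℙⁿ)`. -/
def ratMap : Scheme.RationalMap (PP n) (Gr n d) :=
  Scheme.PartialMap.toRationalMap ⟨torus n, dense_torus n, 𝓐.torusMap⟩

/-- The ideal sheaf of the Hurwitz discriminant `∇_Hu(X)`: the scheme-theoretic closure in `ℙⁿ` of
the pullback of the first associated hypersurface along `φ`, where `φ` is taken on its maximal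
domain of definition. -/
def nablaHu : (PP n).IdealSheafData :=
  (𝓐.associatedHypersurface.comap 𝓐.ratMap.toPartialMap.hom).map 𝓐.ratMap.toPartialMap.domain.ι

end Arrangement

end LogDisc

end

namespace LogDisc

open TensorProduct

/-! ### Fitting ideals and base change -/

section Fitting

/-! Inclusions of subschemes are reversed inclusions of ideal sheaves, so the Hurwitz ideal has to
lie in the logarithmic one. The reason is that the likelihood correspondence is a base change of the
Hurwitz incidence: `Aᵀ diag(γ(x)) u = Aᵀ diag(u) γ(x)`, so `(u, x)` satisfies the likelihood
equations exactly when `γ(x)` lies in `φ(u) = Ker(Aᵀ diag(u))`.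

This is made precise on the opens `chartOpen c` where no `u_{c k}` vanishes, for `c` with `det A_c ≠
0`. There the minor of `Aᵀ diag(u)` with columns `c` is `det A_c · ∏ u_{c k}`, a unit up to
normalisation, so `φ` is a morphism into one Plücker chart. The Hurwitz equations there are the
likelihood equations multiplied by an invertible matrix (`hurwitzIdeal_comap`).

The third claim then applies. Zeroth Fitting ideals and relative differentials commute with base
change, hence so do ramification schemes (`ram_of_isPullback`). The adjunction between pullback and
scheme-theoretic image gives the inclusion of branch schemes (`branch_comap_le_of_isPullback`). It
is only an inclusion, because images need not commute with base change. Along the open immersion of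
a chart they do (`branch_of_isPullback_of_isOpenImmersion`), so the branch scheme of the restricted
projection is the restriction of `∇_log`. On the Hurwitz side the chart lies in the maximal domain
of `φ` (`ratMap_eq`), so the closure defining `∇_Hu` contains the pullback of the associated
hypersurface to the chart.

It remains to cover the two opens. One chart contains the whole torus. On `D` at most one `uᵢ`
vanishes, and full rank of `Aⁱ` provides a non-zero minor avoiding the row `i`.

Two gluing results make the ideal sheaves computable: `ram` and `incidence` are defined as a largest
and a smallest ideal sheaf, and `exists_ideal_eq` shows that they have the expected ideals on affine
opens (`ram_ideal`, `incidence_ideal_chart`). -/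

/-- If some `n` columns of a square matrix have the property that all `n × n` minors formed from
rows with property `P` lie in an ideal, then so does the whole determinant. -/
lemma det_mem_of_columns {S : Type*} [CommRing S] {n : ℕ} (P : (Fin n → S) → Prop) (I : Ideal S)
    (hI : ∀ Q : Matrix (Fin n) (Fin n) S, (∀ i, P (Q i)) → Q.det ∈ I) (k : ℕ)
    (M : Matrix (Fin (n + k)) (Fin (n + k)) S)
    (hM : ∀ i, P fun j => M i (Fin.castAdd k j)) : M.det ∈ I := by
  induction k with
  | zero => exact hI M hM
  | succ k ih =>
    -- Expansion along the last column removes none of the first `n` columns, so every cofactor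
    -- again satisfies the hypothesis on rows.
    rw [Matrix.det_succ_column (n := n + k) M (Fin.last _)]
    refine Ideal.sum_mem _ fun i _ => Ideal.mul_mem_left _ _ (ih _ fun i' => ?_)
    convert hM ((Fin.succAbove (n := n + k) i) i') using 2 with j
    simp only [Matrix.submatrix_apply, Fin.succAbove_last]
    rfl

/-- Reduces the arbitrary generating families in the Fitting ideal to one fixed family. Express `g`
through `h` by `C` and `h` through `g` by `D`. The block matrix with rows `(D C - 1, D)` and `(a C,
a)` has determinant `± det a`, and its first `n` columns consist of relations among `h`. Laplace
expansion then writes `det a` through `n × n` relation determinants. -/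
lemma fittingIdeal_le_of_det_mem {S M : Type*} [CommRing S] [AddCommGroup M] [Module S M] {n : ℕ}
    (h : Fin n → M) (hh : Submodule.span S (Set.range h) = ⊤) (I : Ideal S)
    (hI : ∀ Q : Matrix (Fin n) (Fin n) S, (∀ i, ∑ j, Q i j • h j = 0) → Q.det ∈ I) :
    fittingIdeal S M ≤ I := by
  rw [fittingIdeal, Ideal.span_le]
  rintro _ ⟨m, g, a, hg, ha, rfl⟩
  have hC (j : Fin m) : ∃ c : Fin n → S, ∑ i, c i • h i = g j := by
    have : g j ∈ Submodule.span S (Set.range h) := hh ▸ Submodule.mem_top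
    exact (Submodule.mem_span_range_iff_exists_fun S).mp this
  have hD (i : Fin n) : ∃ c : Fin m → S, ∑ j, c j • g j = h i := by
    have : h i ∈ Submodule.span S (Set.range g) := hg ▸ Submodule.mem_top
    exact (Submodule.mem_span_range_iff_exists_fun S).mp this
  choose Cm hC using hC
  choose Dm hD using hD
  let C : Matrix (Fin m) (Fin n) S := Matrix.of Cm
  let D : Matrix (Fin n) (Fin m) S := Matrix.of Dm
  have sumC (r : Fin m → S) : ∑ i, (Matrix.vecMul r C) i • h i = ∑ j, r j • g j := by
    simp only [Matrix.vecMul, dotProduct, Finset.sum_smul, ← hC, Finset.smul_sum, C,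
      Matrix.of_apply, mul_smul]
    exact Finset.sum_comm
  have key : Matrix.fromBlocks (-1) D 0 a * Matrix.fromBlocks 1 0 C 1 =
      Matrix.fromBlocks (D * C - 1) D (a * C) a := by
    simp [Matrix.fromBlocks_multiply, sub_eq_add_neg, add_comm]
  have hdet := congrArg Matrix.det key
  simp only [Matrix.det_mul, Matrix.det_fromBlocks_zero₁₂, Matrix.det_fromBlocks_zero₂₁,
    Matrix.det_one, mul_one, Matrix.det_neg] at hdet
  have hu : IsUnit ((-1 : S) ^ Fintype.card (Fin n)) := (isUnit_one.neg).pow _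
  rw [SetLike.mem_coe, ← Ideal.unit_mul_mem_iff_mem I hu, hdet,
    ← Matrix.det_submatrix_equiv_self finSumFinEquiv.symm]
  refine det_mem_of_columns (fun r => ∑ j, r j • h j = 0) I hI m _ fun i => ?_
  refine Fin.addCases (fun i => ?_) (fun i => ?_) i
  · have : ∑ j, (D * C) i j • h j = h i := (sumC (D i)).trans (hD i)
    simp [sub_smul, this, Matrix.one_apply, Finset.sum_sub_distrib]
  · have : ∑ j, (a * C) i j • h j = 0 := (sumC (a i)).trans (ha i)
    simpa using this

/-- Fitting ideals commute with base change. -/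
lemma fittingIdeal_of_tensorEquiv {S S' M M' : Type*} [CommRing S] [CommRing S'] [Algebra S S']
    [AddCommGroup M] [Module S M] [Module.Finite S M] [AddCommGroup M'] [Module S' M']
    (e : S' ⊗[S] M ≃ₗ[S'] M') :
    fittingIdeal S' M' = (fittingIdeal S M).map (algebraMap S S') := by
  have hspan {m : ℕ} {g : Fin m → M} (hg : Submodule.span S (Set.range g) = ⊤) :
      Submodule.span S' (Set.range fun j => e (1 ⊗ₜ g j)) = ⊤ := by
    have h1 := Submodule.baseChange_span (R := S) (A := S') (Set.range g)
    rw [hg, Submodule.baseChange_top, ← Set.range_comp] at h1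
    have h2 := congrArg (Submodule.map e.toLinearMap) h1
    rw [Submodule.map_top, LinearEquiv.range, Submodule.map_span, ← Set.range_comp] at h2
    exact h2.symm
  apply le_antisymm
  · obtain ⟨n, g, hg⟩ := Module.Finite.exists_fin (R := S) (M := M)
    refine fittingIdeal_le_of_det_mem _ (hspan hg) _ fun Q hQ => ?_
    have hQ' (i) : ∑ j, g j ⊗ₜ[S] Q i j = (0 : M ⊗[S] S') := by
      have h := hQ i
      simp only [← map_smul, ← map_sum] at h
      rw [LinearEquiv.map_eq_zero_iff] at h
      simpa [TensorProduct.smul_tmul', map_sum] using congrArg (TensorProduct.comm S S' M) h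
    -- Equational criterion for vanishing: as `g` generates `M`, each relation over `S'` is an
    -- `S'`-combination, with coefficients `y`, of relations `a` over `S`.
    choose k a y ha hy using fun i =>
      TensorProduct.vanishesTrivially_of_sum_tmul_eq_zero S hg (hQ' i)
    have hrow : Q = fun i => ∑ l, y i l • fun j => algebraMap S S' (a i j l) := by
      ext i j
      simp [ha i j, Algebra.smul_def, mul_comm]
    change Matrix.detRowAlternating.toMultilinearMap Q ∈ _
    -- Multilinearity in the rows makes `Q.det` an `S'`-combination of determinants of relation
    -- matrices over `S`.
    rw [hrow, MultilinearMap.map_sum]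
    refine Ideal.sum_mem _ fun r _ => ?_
    rw [MultilinearMap.map_smul_univ]
    refine Ideal.mul_mem_left _ _ ?_
    have : Matrix.detRowAlternating.toMultilinearMap
        (fun i j => algebraMap S S' (a i j (r i))) =
        algebraMap S S' (Matrix.of fun i j => a i j (r i)).det := by
      rw [RingHom.map_det]
      rfl
    rw [this]
    exact Ideal.mem_map_of_mem _ (Ideal.subset_span ⟨n, g, _, hg, fun i => hy i (r i), rfl⟩)
  · rw [Ideal.map_le_iff_le_comap, fittingIdeal, Ideal.span_le]
    rintro _ ⟨m, g, a, hg, ha, rfl⟩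
    rw [SetLike.mem_coe, Ideal.mem_comap, RingHom.map_det]
    refine Ideal.subset_span ⟨m, fun j => e (1 ⊗ₜ g j), _, hspan hg, fun i => ?_, rfl⟩
    simp only [← map_smul, ← map_sum, RingHom.mapMatrix_apply, Matrix.map_apply]
    rw [LinearEquiv.map_eq_zero_iff]
    simp only [algebraMap_smul, ← TensorProduct.tmul_smul, ← TensorProduct.tmul_sum, ha]
    simp

end Fitting

/-! ### Ramification ideals under base change and localization -/

section Ramification

/-- Ramification ideals commute with base change. -/
lemma ramificationIdeal_of_isPushout {R S R' S' : CommRingCat.{0}} (φ : R ⟶ S) (ψ : R ⟶ R')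
    (ψ' : S ⟶ S') (φ' : R' ⟶ S') (hφ : φ.hom.FiniteType) (h : IsPushout ψ φ φ' ψ') :
    ramificationIdeal φ'.hom = (ramificationIdeal φ.hom).map ψ'.hom := by
  algebraize [φ.hom, ψ.hom, ψ'.hom, φ'.hom, (ψ ≫ φ').hom]
  have : IsScalarTower R R' S' := .of_algebraMap_eq fun _ => rfl
  have : IsScalarTower R S S' := .of_algebraMap_eq' congr($(h.1.1).hom)
  have : Algebra.IsPushout R R' S S' := (CommRingCat.isPushout_iff_isPushout).mp h
  have : Module.Finite S (Ω[S⁄R]) := inferInstance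
  exact fittingIdeal_of_tensorEquiv (KaehlerDifferential.tensorKaehlerEquiv R R' S S')

/-- Ramification ideals commute with localization of the source. -/
lemma ramificationIdeal_comp_of_isLocalization {R S T : Type*} [CommRing R] [CommRing S]
    [CommRing T] [Algebra S T] (g : S) [IsLocalization.Away g T] (φ : R →+* S)
    (hφ : φ.FiniteType) :
    ramificationIdeal ((algebraMap S T).comp φ) = (ramificationIdeal φ).map (algebraMap S T) := by
  algebraize [φ, (algebraMap S T).comp φ]
  -- Localizations are formally étale, so `Ω[T⁄R]` is the base change of `Ω[S⁄R]`.
  have : Algebra.FormallyEtale S T := .of_isLocalization (Submonoid.powers g)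
  have : Module.Finite S (Ω[S⁄R]) := inferInstance
  exact fittingIdeal_of_tensorEquiv
    (KaehlerDifferential.tensorKaehlerEquivOfFormallyEtale R S T)

end Ramification

end LogDisc

namespace AlgebraicGeometry.Scheme.IdealSheafData

/-! ### Ideal sheaves on affine opens -/

/-- Both ideals are tested against all ideals `K` of the source: on an affine scheme these are ideal
sheaves, pullback is left adjoint to `map`, and `map` along an affine morphism is the preimage of
ideals. -/
lemma ideal_comap_top_of_isAffine {X Y : Scheme.{0}} [IsAffine X] [IsAffine Y]
    (I : Y.IdealSheafData) (h : X ⟶ Y) :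
    (I.comap h).ideal ⟨⊤, isAffineOpen_top X⟩ =
      (I.ideal ⟨⊤, isAffineOpen_top Y⟩).map h.appTop.hom := by
  refine eq_of_forall_ge_iff fun K => ?_
  obtain ⟨K, rfl⟩ : ∃ K' : X.IdealSheafData, K'.ideal ⟨⊤, isAffineOpen_top X⟩ = K :=
    ⟨equivOfIsAffine.symm K, equivOfIsAffine.apply_symm_apply K⟩
  rw [Ideal.map_le_iff_le_comap]
  have e1 : (I.comap h).ideal ⟨⊤, isAffineOpen_top X⟩ ≤ K.ideal ⟨⊤, isAffineOpen_top X⟩ ↔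
      I.comap h ≤ K := ⟨le_of_isAffine, fun h => h _⟩
  have e2 : I ≤ K.map h ↔
      I.ideal ⟨⊤, isAffineOpen_top Y⟩ ≤ (K.map h).ideal ⟨⊤, isAffineOpen_top Y⟩ :=
    ⟨fun h => h _, le_of_isAffine⟩
  rw [e1, ← le_map_iff_comap_le, e2, ideal_map_of_isAffineHom]
  rfl

lemma ideal_comap_ι {Y : Scheme.{0}} (I : Y.IdealSheafData) (U : Y.affineOpens)
    (hT : IsAffineOpen (⊤ : U.1.toScheme.Opens)) :
    (I.comap U.1.ι).ideal ⟨⊤, hT⟩ = (I.ideal U).map (U.1.ι.appLE U.1 ⊤ (by simp)).hom := by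
  rw [ideal_comap_of_isOpenImmersion]
  have h : (⟨U.1.ι ''ᵁ ⊤, hT.image_of_isOpenImmersion U.1.ι⟩ : Y.affineOpens) ≤ U := by
    change U.1.ι ''ᵁ ⊤ ≤ U.1
    simp
  rw [← I.map_ideal h]
  have : (U.1.ι.appLE U.1 ⊤ (by simp)) = Y.presheaf.map (homOfLE h).op ≫
      (U.1.ι.appIso ⊤).hom := by
    rw [Scheme.Hom.appIso_hom', Scheme.Hom.map_appLE]
  rw [this, CommRingCat.hom_comp, ← Ideal.map_map]
  exact (Ideal.map_comap_of_equiv (U.1.ι.appIso ⊤).commRingCatIsoToRingEquiv).symm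

/-- The pullback of an ideal sheaf, on affine opens. -/
lemma ideal_comap {X Y : Scheme.{0}} (I : Y.IdealSheafData) (h : X ⟶ Y) (U : Y.affineOpens)
    (V : X.affineOpens) (e : V.1 ≤ h ⁻¹ᵁ U.1) :
    (I.comap h).ideal V = (I.ideal U).map (h.appLE U.1 V.1 e).hom := by
  have : IsAffine V.1.toScheme := V.2
  have : IsAffine U.1.toScheme := U.2
  have h1 := (I.comap h).ideal_comap_ι V (isAffineOpen_top _)
  have h2 := I.ideal_comap_ι U (isAffineOpen_top _)
  have h3 := (I.comap U.1.ι).ideal_comap_top_of_isAffine (h.resLE U.1 V.1 e)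
  rw [← comap_comp, Scheme.Hom.resLE_comp_ι, comap_comp, h1, h2, Ideal.map_map,
    ← CommRingCat.hom_comp] at h3
  have h4 : U.1.ι.appLE U.1 ⊤ (by simp) ≫ (h.resLE U.1 V.1 e).appTop =
      h.appLE U.1 V.1 e ≫ V.1.ι.appLE V.1 ⊤ (by simp) := by
    have (g : V.1.toScheme ⟶ Y) (hg : g = V.1.ι ≫ h) (e') :
        g.appLE U.1 ⊤ e' = h.appLE U.1 V.1 e ≫ V.1.ι.appLE V.1 ⊤ (by simp) := by
      subst hg
      rw [Scheme.Hom.appLE_comp_appLE]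
    refine Eq.trans ?_ (this (h.resLE U.1 V.1 e ≫ U.1.ι) (h.resLE_comp_ι e)
        (by rw [Scheme.Hom.comp_preimage]; simp))
    rw [Scheme.Hom.appTop, ← Scheme.Hom.appLE_eq_app]
    exact Scheme.Hom.appLE_comp_appLE _ _ _ _ _ _ _
  rw [h4, CommRingCat.hom_comp, ← Ideal.map_map] at h3
  -- Sections over `V` agree with global sections of the scheme `V`, so the equality on that scheme
  -- descends to the two ideals.
  have h5 := ConcreteCategory.bijective_of_isIso (V.1.ι.appLE V.1 ⊤ V.1.ι_preimage_self.ge)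
  have h6 := congrArg (Ideal.comap (V.1.ι.appLE V.1 ⊤ V.1.ι_preimage_self.ge).hom) h3
  rwa [Ideal.comap_map_of_bijective _ h5, Ideal.comap_map_of_bijective _ h5] at h6

/-- Ideals on sufficiently many affine opens that are compatible with restriction to basic opens
glue to an ideal sheaf. -/
lemma exists_ideal_eq {X : Scheme.{0}} (B : X.affineOpens → Prop)
    (K : ∀ U : X.affineOpens, Ideal Γ(X, U.1))
    (hB : ∀ U V : X.affineOpens, B U → V.1 ≤ U.1 → B V)
    (hK : ∀ (U V : X.affineOpens) (h : V.1 ≤ U.1) (g : Γ(X, U.1)), B U → V.1 = X.basicOpen g →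
      (K U).map (X.presheaf.map (homOfLE h).op).hom = K V)
    (hcov : ∀ x : X, ∃ U : X.affineOpens, x ∈ U.1 ∧ B U) :
    ∃ J : X.IdealSheafData, ∀ U, B U → J.ideal U = K U := by
  -- the stalks of the ideal sheaf
  have hstalk (U V : X.affineOpens) (hU : B U) (hV : B V) (x : X) (hxU : x ∈ U.1) (hxV : x ∈ V.1) :
      (K U).map (X.presheaf.germ U.1 x hxU).hom = (K V).map (X.presheaf.germ V.1 x hxV).hom := by
    obtain ⟨f, g, hfg, hxf⟩ := exists_basicOpen_le_affine_inter U.2 V.2 x ⟨hxU, hxV⟩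
    let O : X.affineOpens := ⟨X.basicOpen f, U.2.basicOpen f⟩
    have hOU : O.1 ≤ U.1 := X.basicOpen_le f
    have hOV : O.1 ≤ V.1 := hfg.trans_le (X.basicOpen_le g)
    have := congrArg (Ideal.map (X.presheaf.germ O.1 x hxf).hom)
      ((hK U O hOU f hU rfl).trans (hK V O hOV g hV hfg).symm)
    simpa only [Ideal.map_map, ← CommRingCat.hom_comp, TopCat.Presheaf.germ_res] using this
  choose W hxW hBW using hcov
  let Kx (x : X) : Ideal (X.presheaf.stalk x) :=
    (K (W x)).map (X.presheaf.germ (W x).1 x (hxW x)).hom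
  have hKx (U : X.affineOpens) (hU : B U) (x : X) (hx : x ∈ U.1) :
      (K U).map (X.presheaf.germ U.1 x hx).hom = Kx x :=
    hstalk _ _ hU (hBW x) x hx (hxW x)
  -- Sections whose germs all lie in the prescribed stalk ideals; this makes sense on every affine
  -- open, whether or not it satisfies `B`.
  let J (U : X.affineOpens) : Ideal Γ(X, U.1) :=
    ⨅ (x : X) (hx : x ∈ U.1), (Kx x).comap (X.presheaf.germ U.1 x hx).hom
  have hmemJ (U : X.affineOpens) (s : Γ(X, U.1)) :
      s ∈ J U ↔ ∀ (x : X) (hx : x ∈ U.1), X.presheaf.germ U.1 x hx s ∈ Kx x := by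
    simp only [J, Ideal.mem_iInf, Ideal.mem_comap]
  have hmemK (U : X.affineOpens) (hU : B U) (s : Γ(X, U.1)) : s ∈ J U ↔ s ∈ K U := by
    rw [hmemJ, U.2.mem_ideal_iff]
    refine forall₂_congr fun x hx => ?_
    rw [hKx U hU x hx]
  -- This is quasi-coherence of `J`. A section `t` near `x` becomes, after multiplication by a power
  -- of `f`, the restriction of some `a` on `U`. Near any other point, `a` lies in the ideal after
  -- restriction to `D(f)`, so a power of `f` moves it into the ideal. Compactness of `U` gives one
  -- exponent for all points, and `f` is a unit at `x`.
  have hJ (U : X.affineOpens) (x : X) (hx : x ∈ U.1) :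
      (J U).map (X.presheaf.germ U.1 x hx).hom = Kx x := by
    apply le_antisymm
    · exact Ideal.map_le_iff_le_comap.mpr (iInf₂_le x hx)
    · change Ideal.map _ _ ≤ _
      rw [Ideal.map_le_iff_le_comap]
      intro t ht
      obtain ⟨f, g, hfg, hxf⟩ :=
        exists_basicOpen_le_affine_inter U.2 (W x).2 x ⟨hx, hxW x⟩
      let O : X.affineOpens := ⟨X.basicOpen f, U.2.basicOpen f⟩
      have hOU : O.1 ≤ U.1 := X.basicOpen_le f
      have hOW : O.1 ≤ (W x).1 := hfg.trans_le (X.basicOpen_le g)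
      have hBO : B O := hB _ _ (hBW x) hOW
      have := U.2.isLocalization_basicOpen f
      obtain ⟨n, a, ha⟩ := IsLocalization.Away.surj f (S := Γ(X, X.basicOpen f))
        (X.presheaf.map (homOfLE hOW).op t)
      -- the germs of `a` on `D(f)`
      have hgerm (z : X) (hzU : z ∈ U.1) (hz : z ∈ X.basicOpen f) (hzW : z ∈ (W x).1) :
          X.presheaf.germ U.1 z hzU a =
            X.presheaf.germ (W x).1 z hzW t * X.presheaf.germ U.1 z hzU f ^ n := by
        have := congrArg (X.presheaf.germ (X.basicOpen f) z hz) ha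
        rw [map_mul, map_pow] at this
        erw [TopCat.Presheaf.germ_res_apply, TopCat.Presheaf.germ_res_apply,
          TopCat.Presheaf.germ_res_apply] at this
        exact this.symm
      have hN : ∃ N : ℕ, f ^ N * a ∈ J U := by
        have hloc (y : U.1) : ∃ (O : X.affineOpens) (_ : y.1 ∈ O.1) (h : O.1 ≤ U.1) (N : ℕ),
            B O ∧ X.presheaf.map (homOfLE h).op (f ^ N * a) ∈ K O := by
          obtain ⟨y, hy⟩ := y
          obtain ⟨p, q, hpq, hyp⟩ :=
            exists_basicOpen_le_affine_inter U.2 (W y).2 y ⟨hy, hxW y⟩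
          let P : X.affineOpens := ⟨X.basicOpen p, U.2.basicOpen p⟩
          have hPU : P.1 ≤ U.1 := X.basicOpen_le p
          have hBP : B P := hB _ _ (hBW y) (hpq.trans_le (X.basicOpen_le q))
          let f' : Γ(X, P.1) := X.presheaf.map (homOfLE hPU).op f
          let a' : Γ(X, P.1) := X.presheaf.map (homOfLE hPU).op a
          let Q : X.affineOpens := ⟨X.basicOpen f', P.2.basicOpen f'⟩
          have hQP : Q.1 ≤ P.1 := X.basicOpen_le f'
          have hQ : Q.1 ≤ X.basicOpen f := by
            change X.basicOpen f' ≤ _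
            rw [Scheme.basicOpen_res]
            exact inf_le_right
          have hmem : X.presheaf.map (homOfLE hQP).op a' ∈ K Q := by
            rw [← hmemK Q (hB _ _ hBP hQP), hmemJ]
            intro z hz
            have h1 := hgerm z (hPU (hQP hz)) (hQ hz) (hOW (hQ hz))
            have h2 : X.presheaf.germ Q.1 z hz (X.presheaf.map (homOfLE hQP).op a') =
                X.presheaf.germ U.1 z (hPU (hQP hz)) a := by
              simp only [a', TopCat.Presheaf.germ_res_apply]
            rw [h2, h1]
            refine Ideal.mul_mem_right _ _ ?_
            rw [← hKx (W x) (hBW x) z (hOW (hQ hz))]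
            exact Ideal.mem_map_of_mem _ ht
          rw [← hK P Q hQP f' hBP rfl] at hmem
          have := P.2.isLocalization_basicOpen f'
          have hmem' : algebraMap Γ(X, P.1) Γ(X, X.basicOpen f') a' ∈
              (K P).map (algebraMap Γ(X, P.1) Γ(X, X.basicOpen f')) := hmem
          rw [IsLocalization.algebraMap_mem_map_algebraMap_iff (Submonoid.powers f')] at hmem'
          obtain ⟨_, ⟨N, rfl⟩, hN⟩ := hmem'
          refine ⟨P, hyp, hPU, N, hBP, ?_⟩
          rw [map_mul, map_pow]
          exact hN
        choose O hyO hOU N hBO hN using hloc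
        obtain ⟨s, hs⟩ := U.2.isCompact.elim_finite_subcover (fun y : U.1 => ((O y).1 : Set X))
          (fun y => (O y).1.2) fun y hy => Set.mem_iUnion.mpr ⟨⟨y, hy⟩, hyO ⟨y, hy⟩⟩
        refine ⟨s.sup fun y => N y, ?_⟩
        rw [hmemJ]
        intro z hz
        obtain ⟨y, hys, hzy⟩ := Set.mem_iUnion₂.mp (hs hz)
        have h1 := Ideal.mem_map_of_mem (X.presheaf.germ (O y).1 z hzy).hom (hN y)
        rw [hKx _ (hBO y)] at h1
        have h2 : X.presheaf.germ (O y).1 z hzy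
            (X.presheaf.map (homOfLE (hOU y)).op (f ^ N y * a)) =
            X.presheaf.germ U.1 z hz (f ^ N y * a) := by
          simp only [TopCat.Presheaf.germ_res_apply]
        have h1' : X.presheaf.germ U.1 z hz (f ^ N y * a) ∈ Kx z := h2 ▸ h1
        obtain ⟨m, hm⟩ := Nat.exists_eq_add_of_le (Finset.le_sup (f := fun y : U.1 => N y) hys)
        have h3 : f ^ (s.sup fun y : U.1 => N y) * a = f ^ m * (f ^ N y * a) := by
          rw [hm]
          ring
        rw [h3, map_mul]
        exact Ideal.mul_mem_left _ _ h1'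
      obtain ⟨N, hN⟩ := hN
      have hu : IsUnit (X.presheaf.germ U.1 x hx f) := by
        rwa [← Scheme.mem_basicOpen]
      have h1 := Ideal.mem_map_of_mem (X.presheaf.germ U.1 x hx).hom hN
      have h2 : (X.presheaf.germ U.1 x hx).hom (f ^ N * a) =
          X.presheaf.germ U.1 x hx f ^ (N + n) * X.presheaf.germ (W x).1 x (hxW x) t := by
        rw [map_mul, map_pow]
        change X.presheaf.germ U.1 x hx f ^ N * X.presheaf.germ U.1 x hx a = _
        rw [hgerm x hx hxf (hxW x)]
        ring
      rw [h2, Ideal.unit_mul_mem_iff_mem _ (hu.pow _)] at h1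
      exact h1
  refine ⟨⟨J, fun U f => ?_, _, rfl⟩, fun U hU => Ideal.ext fun s => hmemK U hU s⟩
  refine (X.affineBasicOpen f).2.ideal_ext_iff.mpr fun x hx => ?_
  refine Eq.trans ?_ (hJ (X.affineBasicOpen f) x hx).symm
  rw [← hJ U x (X.basicOpen_le f hx), ← X.presheaf.germ_res (homOfLE (X.basicOpen_le f)) x hx,
    CommRingCat.hom_comp, ← Ideal.map_map]
  rfl

end AlgebraicGeometry.Scheme.IdealSheafData

namespace LogDisc

/-! ### Ramification and branch schemes under base change -/

/-- A fibre product of affine opens corresponds to a pushout of their rings of sections, where base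
change of ramification ideals applies. -/
lemma ramificationIdeal_of_isPullback {X Y X' Y' : Scheme.{0}} {f : X ⟶ Y} {f' : X' ⟶ Y'}
    {φ : Y' ⟶ Y} {φ' : X' ⟶ X} [LocallyOfFiniteType f] (h : IsPullback φ' f' f φ)
    (U : X.affineOpens) (V : Y.affineOpens) (V' : Y'.affineOpens) (U' : X'.Opens)
    (eUV : U.1 ≤ f ⁻¹ᵁ V.1) (eV : V'.1 ≤ φ ⁻¹ᵁ V.1) (hU' : U' = φ' ⁻¹ᵁ U.1 ⊓ f' ⁻¹ᵁ V'.1) :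
    ramificationIdeal (f'.appLE V'.1 U' (hU'.trans_le inf_le_right)).hom =
      (ramificationIdeal (f.appLE V.1 U.1 eUV).hom).map
        (φ'.appLE U.1 U' (hU'.trans_le inf_le_left)).hom :=
  ramificationIdeal_of_isPushout _ _ _ _ (f.finiteType_appLE V.2 U.2 eUV)
    ((isIso_pushoutSection_iff h eV eUV hU').mp
      (isIso_pushoutSection_of_isAffineOpen h eV eUV hU' V.2 V'.2 U.2)).flip

section

variable {X Y : Scheme.{0}} (f : X ⟶ Y) [LocallyOfFiniteType f]

/-- Shrinking the affine target is base change along the trivial square of identities, with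
different affine opens chosen in its two copies of `Y`. -/
lemma ramificationIdeal_restrict_target (U : X.affineOpens) (V V' : Y.affineOpens) (O : X.Opens)
    (eUV : U.1 ≤ f ⁻¹ᵁ V.1) (eV : V'.1 ≤ V.1) (hO : O = U.1 ⊓ f ⁻¹ᵁ V'.1) :
    ramificationIdeal (f.appLE V'.1 O (hO.trans_le inf_le_right)).hom =
      (ramificationIdeal (f.appLE V.1 U.1 eUV).hom).map
        (X.presheaf.map (homOfLE (hO.trans_le inf_le_left)).op).hom := by
  have h : IsPullback (𝟙 X) f f (𝟙 Y) := IsPullback.of_id_fst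
  rw [ramificationIdeal_of_isPullback h U V V' O eUV (by simpa using eV) (by simpa using hO)]
  have : (𝟙 X : X ⟶ X).appLE U.1 O (hO.trans_le inf_le_left) =
      X.presheaf.map (homOfLE (hO.trans_le inf_le_left)).op := by
    rw [Scheme.Hom.appLE, Scheme.Hom.id_app]
    exact Category.id_comp _
  rw [← this]

lemma ramificationIdeal_basicOpen (U : X.affineOpens) (V : Y.affineOpens) (O : X.affineOpens)
    (eUV : U.1 ≤ f ⁻¹ᵁ V.1) (g : Γ(X, U.1)) (h : O.1 ≤ U.1) (hO : O.1 = X.basicOpen g) :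
    ramificationIdeal (f.appLE V.1 O.1 (h.trans eUV)).hom =
      (ramificationIdeal (f.appLE V.1 U.1 eUV).hom).map (X.presheaf.map (homOfLE h).op).hom := by
  algebraize [(X.presheaf.map (homOfLE h).op).hom]
  have : IsLocalization.Away g Γ(X, O.1) := U.2.isLocalization_of_eq_basicOpen g (homOfLE h) hO
  have := ramificationIdeal_comp_of_isLocalization (T := Γ(X, O.1)) g (f.appLE V.1 U.1 eUV).hom
    (f.finiteType_appLE V.2 U.2 eUV)
  refine Eq.trans ?_ this
  congr 1
  rw [← Scheme.Hom.appLE_map f eUV (homOfLE h).op]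
  rfl

/-- Compared on stalks: around `f x` both targets contain a common affine open, and both ideals
restrict to the ramification ideal over it. Hence the infimum over targets in `ram` has equal
members. -/
lemma ramificationIdeal_eq (U : X.affineOpens) (V V' : Y.affineOpens)
    (e : U.1 ≤ f ⁻¹ᵁ V.1) (e' : U.1 ≤ f ⁻¹ᵁ V'.1) :
    ramificationIdeal (f.appLE V.1 U.1 e).hom = ramificationIdeal (f.appLE V'.1 U.1 e').hom := by
  rw [U.2.ideal_ext_iff]
  intro x hx
  obtain ⟨r, r', hr, hxr⟩ := exists_basicOpen_le_affine_inter V.2 V'.2 (f x) ⟨e hx, e' hx⟩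
  let V'' : Y.affineOpens := ⟨Y.basicOpen r, V.2.basicOpen r⟩
  have h1 := ramificationIdeal_restrict_target f U V V'' _ e (Y.basicOpen_le r) rfl
  have h2 := ramificationIdeal_restrict_target f U V' V'' _ e'
    (hr.trans_le (Y.basicOpen_le r')) rfl
  have hxO : x ∈ U.1 ⊓ f ⁻¹ᵁ V''.1 := ⟨hx, hxr⟩
  have := congrArg (Ideal.map (X.presheaf.germ _ x hxO).hom) (h1.symm.trans h2)
  simpa only [Ideal.map_map, ← CommRingCat.hom_comp, TopCat.Presheaf.germ_res] using this

/-- The ramification scheme on the affine opens that are mapped into an affine open. -/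
lemma ram_ideal (U : X.affineOpens) (V : Y.affineOpens) (e : U.1 ≤ f ⁻¹ᵁ V.1) :
    (ram f).ideal U = ramificationIdeal (f.appLE V.1 U.1 e).hom := by
  let K (U : X.affineOpens) : Ideal Γ(X, U.1) :=
    ⨅ (V : Y.affineOpens) (e : U.1 ≤ f ⁻¹ᵁ V.1), ramificationIdeal (f.appLE V.1 U.1 e).hom
  have hK (U : X.affineOpens) (V : Y.affineOpens) (e : U.1 ≤ f ⁻¹ᵁ V.1) :
      K U = ramificationIdeal (f.appLE V.1 U.1 e).hom :=
    le_antisymm (iInf₂_le V e) (le_iInf₂ fun V' e' => (ramificationIdeal_eq f U V V' e e').le)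
  obtain ⟨J, hJ⟩ := Scheme.IdealSheafData.exists_ideal_eq
    (fun U => ∃ V : Y.affineOpens, U.1 ≤ f ⁻¹ᵁ V.1) K
    (fun U O ⟨V, e⟩ h => ⟨V, h.trans e⟩)
    (fun U O h g ⟨V, e⟩ hO => by
      rw [hK U V e, hK O V (h.trans e), ramificationIdeal_basicOpen f U V O e g h hO])
    (fun x => by
      obtain ⟨_, ⟨V, hV, rfl⟩, hxV, -⟩ :=
        Y.isBasis_affineOpens.exists_subset_of_mem_open (Set.mem_univ (f x)) isOpen_univ
      obtain ⟨_, ⟨U, hU, rfl⟩, hxU, hUV⟩ :=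
        X.isBasis_affineOpens.exists_subset_of_mem_open (a := x) (u := (f ⁻¹ᵁ V : Set X)) hxV
          (f ⁻¹ᵁ V).2
      exact ⟨⟨U, hU⟩, hxU, ⟨V, hV⟩, hUV⟩)
  rw [← hK U V e]
  -- `ofIdeals` is the largest ideal sheaf below the family `K`, so it dominates the glued sheaf `J`
  -- once `J ≤ K` everywhere. Where no target is available, `K` is an empty infimum, that is `⊤`.
  refine le_antisymm (Scheme.IdealSheafData.ideal_ofIdeals_le K U) ?_
  rw [← hJ U ⟨V, e⟩]
  refine (Scheme.IdealSheafData.le_ofIdeals_iff (J := K)).mpr (fun U' => ?_) U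
  by_cases h : ∃ V : Y.affineOpens, U'.1 ≤ f ⁻¹ᵁ V.1
  · exact (hJ U' h).le
  · refine le_iInf₂ fun V e => (h ⟨V, e⟩).elim

end

/-- The formation of the ramification scheme commutes with base change. -/
lemma ram_of_isPullback {X Y X' Y' : Scheme.{0}} {f : X ⟶ Y} {f' : X' ⟶ Y'}
    {φ : Y' ⟶ Y} {φ' : X' ⟶ X} [LocallyOfFiniteType f] (h : IsPullback φ' f' f φ) :
    ram f' = (ram f).comap φ' := by
  have : LocallyOfFiniteType f' := MorphismProperty.of_isPullback h inferInstance
  -- Indices of the affine pieces `U ×_V V'` of the fibre product, on which both ideals are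
  -- explicit.
  let ι := {p : X.affineOpens × Y.affineOpens × Y'.affineOpens //
    p.1.1 ≤ f ⁻¹ᵁ p.2.1.1 ∧ p.2.2.1 ≤ φ ⁻¹ᵁ p.2.1.1}
  have haff (p : ι) : IsAffineOpen (φ' ⁻¹ᵁ p.1.1.1 ⊓ f' ⁻¹ᵁ p.1.2.2.1) := by
    have : IsAffine p.1.1.1.toScheme := p.1.1.2
    have : IsAffine p.1.2.1.1.toScheme := p.1.2.1.2
    have : IsAffine p.1.2.2.1.toScheme := p.1.2.2.2
    exact .of_isIso (Scheme.Hom.isPullback_resLE h p.2.2 p.2.1 rfl).isoPullback.hom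
  refine Scheme.IdealSheafData.ext_of_iSup_eq_top (ι := ι) (fun p => ⟨_, haff p⟩) ?_ fun p => ?_
  · rw [eq_top_iff]
    rintro x -
    rw [Opens.mem_iSup]
    obtain ⟨_, ⟨V, hV, rfl⟩, hxV, -⟩ :=
      Y.isBasis_affineOpens.exists_subset_of_mem_open (Set.mem_univ (f (φ' x))) isOpen_univ
    obtain ⟨_, ⟨U, hU, rfl⟩, hxU, hUV⟩ :=
      X.isBasis_affineOpens.exists_subset_of_mem_open (a := φ' x) (u := (f ⁻¹ᵁ V : Set X)) hxV
        (f ⁻¹ᵁ V).2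
    have hxV' : f' x ∈ (φ ⁻¹ᵁ V : Set Y') := by
      change φ (f' x) ∈ V
      rw [← Scheme.Hom.comp_apply, ← h.w, Scheme.Hom.comp_apply]
      exact hxV
    obtain ⟨_, ⟨V', hV', rfl⟩, hxV', hVV'⟩ :=
      Y'.isBasis_affineOpens.exists_subset_of_mem_open hxV' (φ ⁻¹ᵁ V).2
    exact ⟨⟨⟨⟨U, hU⟩, ⟨V, hV⟩, ⟨V', hV'⟩⟩, hUV, hVV'⟩, hxU, hxV'⟩
  · rw [ram_ideal f' ⟨_, haff p⟩ p.1.2.2 inf_le_right,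
      Scheme.IdealSheafData.ideal_comap _ φ' p.1.1 ⟨_, haff p⟩ inf_le_left,
      ram_ideal f p.1.1 p.1.2.1 p.2.1]
    exact ramificationIdeal_of_isPullback h p.1.1 p.1.2.1 p.1.2.2 _ p.2.1 p.2.2 rfl

/-- By adjunction the inclusion is checked after pullback along `f'`. As `f' ≫ φ = φ' ≫ f`, it
becomes the pullback along `φ'` of the statement that `Ram(f)` maps into its image. -/
lemma branch_comap_le_of_isPullback {X Y X' Y' : Scheme.{0}} {f : X ⟶ Y} {f' : X' ⟶ Y'}
    {φ : Y' ⟶ Y} {φ' : X' ⟶ X} [LocallyOfFiniteType f] (h : IsPullback φ' f' f φ) :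
    (branch f).comap φ ≤ branch f' := by
  rw [branch, branch, Scheme.IdealSheafData.le_map_iff_comap_le,
    ← Scheme.IdealSheafData.comap_comp, ← h.w, Scheme.IdealSheafData.comap_comp,
    ram_of_isPullback h]
  exact Scheme.IdealSheafData.comap_mono _ (Scheme.IdealSheafData.comap_map_le _ _)

/-- The formation of the branch scheme of a quasi-compact morphism is local on the target. -/
lemma branch_of_isPullback_of_isOpenImmersion {X Y X' Y' : Scheme.{0}} {f : X ⟶ Y} {f' : X' ⟶ Y'}
    {φ : Y' ⟶ Y} {φ' : X' ⟶ X} [LocallyOfFiniteType f] [QuasiCompact f] [IsOpenImmersion φ]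
    (h : IsPullback φ' f' f φ) : branch f' = (branch f).comap φ := by
  -- The pulled back ramification scheme is a base change of `Ram(f)`. Pasted with `h`, it is the
  -- restriction over an open of the quasi-compact `Ram(f) ⟶ Y`, and kernels of such morphisms are
  -- local on the target.
  have h1 : IsPullback (((ram f).comapIso φ').hom ≫ pullback.snd _ _)
      ((ram f).comap φ').subschemeι (ram f).subschemeι φ' :=
    IsPullback.of_iso_pullback ⟨by simp⟩ (((ram f).comapIso φ') ≪≫ pullbackSymmetry _ _)
      (by simp) (by simp)
  have h2 := h1.paste_vert h
  rw [branch, ram_of_isPullback h]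
  ext W : 2
  rw [Scheme.IdealSheafData.ideal_comap_of_isOpenImmersion]
  exact Scheme.ker_ideal_of_isPullback_of_isOpenImmersion _ _ _ _ h2.flip W

end LogDisc

namespace LogDisc

/-! ### Incidence schemes on charts -/

/-- Compatible families of sections on the members of an affine open cover generate an ideal
sheaf. -/
lemma ideal_sInf_eq_span {X : Scheme.{0}} {ι κ : Type} (U : ι → X.affineOpens)
    (hU : ⨆ i, (U i).1 = ⊤) (E : ∀ i, κ → Γ(X, (U i).1))
    (hE : ∀ i i' k, X.presheaf.map (homOfLE (inf_le_left : (U i).1 ⊓ (U i').1 ≤ (U i).1)).op (E i k) ∈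
      (Ideal.span (Set.range (E i'))).map
        (X.presheaf.map (homOfLE (inf_le_right : (U i).1 ⊓ (U i').1 ≤ (U i').1)).op).hom) (i : ι) :
    (sInf {I : X.IdealSheafData | ∀ i k, E i k ∈ I.ideal (U i)}).ideal (U i) =
      Ideal.span (Set.range (E i)) := by
  let L (W : X.Opens) (i : ι) (h : W ≤ (U i).1) : Ideal Γ(X, W) :=
    (Ideal.span (Set.range (E i))).map (X.presheaf.map (homOfLE h).op).hom
  have hLres (W W' : X.Opens) (i : ι) (h : W ≤ (U i).1) (h' : W' ≤ W) :
      (L W i h).map (X.presheaf.map (homOfLE h').op).hom = L W' i (h'.trans h) := by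
    rw [Ideal.map_map, ← CommRingCat.hom_comp, ← Functor.map_comp, ← op_comp, homOfLE_comp]
  have hLle (W : X.Opens) (i i' : ι) (h : W ≤ (U i).1) (h' : W ≤ (U i').1) :
      L W i h ≤ L W i' h' := by
    rw [← hLres _ W i inf_le_left (le_inf h h'), ← hLres _ W i' inf_le_right (le_inf h h')]
    refine Ideal.map_mono ?_
    rw [Ideal.map_le_iff_le_comap, Ideal.span_le]
    rintro _ ⟨k, rfl⟩
    exact hE i i' k
  -- All members of the cover containing `W` yield the same ideal, so the supremum equals each of
  -- its terms.
  let K (W : X.affineOpens) : Ideal Γ(X, W.1) := ⨆ (i : ι) (h : W.1 ≤ (U i).1), L W.1 i h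
  have hK (W : X.affineOpens) (i : ι) (h : W.1 ≤ (U i).1) : K W = L W.1 i h :=
    le_antisymm (iSup₂_le fun i' h' => hLle _ _ _ _ _) (le_iSup₂_of_le i h le_rfl)
  obtain ⟨J, hJ⟩ := Scheme.IdealSheafData.exists_ideal_eq (fun W => ∃ i, W.1 ≤ (U i).1) K
    (fun W O ⟨i, e⟩ h => ⟨i, h.trans e⟩)
    (fun W O h g ⟨i, e⟩ hO => by rw [hK W i e, hK O i (h.trans e), hLres])
    (fun x => by
      obtain ⟨i, hi⟩ := Opens.mem_iSup.mp (hU.ge (Set.mem_univ x))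
      exact ⟨U i, hi, i, le_rfl⟩)
  have hJU (i : ι) : J.ideal (U i) = Ideal.span (Set.range (E i)) := by
    rw [hJ _ ⟨i, le_rfl⟩, hK _ i le_rfl]
    simp only [L]
    rw [show homOfLE (le_refl (U i).1) = 𝟙 _ from rfl, op_id, X.presheaf.map_id]
    exact Ideal.map_id _
  have : sInf {I : X.IdealSheafData | ∀ i k, E i k ∈ I.ideal (U i)} = J := by
    refine le_antisymm (sInf_le fun i k => ?_) (le_sInf fun I hI => ?_)
    · rw [hJU]
      exact Ideal.subset_span ⟨k, rfl⟩
    · refine Scheme.IdealSheafData.le_of_iSup_eq_top U hU fun i => ?_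
      rw [hJU, Ideal.span_le]
      rintro _ ⟨k, rfl⟩
      exact hI i k
  rw [this, hJU]

section Incidence

variable {A : Type} [CommRing A] [Algebra ℂ A] {𝒜 : ℕ → Submodule ℂ A} [GradedAlgebra 𝒜]
variable (R : Type) [CommRing R] [Algebra ℂ R]

/-- On `D₊(f g)`, quotients of elements of degree one by `f` and by `g` satisfy the relations of
their numerators. -/
lemma awayMap_quot_eq_sum {κ : Type} [Fintype κ] {f g a : A} (hf : f ∈ 𝒜 1) (hg : g ∈ 𝒜 1)
    (ha : a ∈ 𝒜 1) {N b : κ → A} (hN : ∀ k, N k ∈ 𝒜 1) (hb : ∀ k, b k ∈ 𝒜 1)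
    (h : a * g = ∑ k, N k * b k) :
    HomogeneousLocalization.awayMap 𝒜 hg (rfl : f * g = f * g) (quot hf ha) =
      ∑ k, HomogeneousLocalization.awayMap 𝒜 hg (rfl : f * g = f * g) (quot hf (hN k)) *
        HomogeneousLocalization.awayMap 𝒜 hf (mul_comm f g) (quot hg (hb k)) := by
  apply HomogeneousLocalization.val_injective
  have hval {f g a : A} (hf : f ∈ 𝒜 1) (hg : g ∈ 𝒜 1) (ha : a ∈ 𝒜 1) {x : A} (hx : x = f * g) :
      (HomogeneousLocalization.awayMap 𝒜 hg hx (quot hf ha)).val =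
        Localization.mk (a * g) ⟨x, Submonoid.mem_powers _⟩ := by
    rw [quot, HomogeneousLocalization.Away.mk, HomogeneousLocalization.val_awayMap_mk]
    simp
  have key (k : κ) : (HomogeneousLocalization.awayMap 𝒜 hg (rfl : f * g = f * g) (quot hf (hN k)) *
        HomogeneousLocalization.awayMap 𝒜 hf (mul_comm f g) (quot hg (hb k))).val =
      Localization.mk (N k * b k) ⟨f * g, Submonoid.mem_powers _⟩ := by
    rw [HomogeneousLocalization.val_mul, hval, hval, Localization.mk_mul,
      Localization.mk_eq_mk_iff, Localization.r_iff_exists]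
    exact ⟨1, by simp; ring⟩
  simp only [← HomogeneousLocalization.algebraMap_apply] at key ⊢
  rw [map_sum]
  simp only [key]
  rw [← Localization.mk_sum, ← h]
  exact hval hf hg ha rfl

variable {ι κ τ : Type} [Fintype τ] [Fintype κ] {f : ι → A} (hf : ∀ i, f i ∈ 𝒜 1)
    {M : ι → κ → τ → A} (hM : ∀ i k j, M i k j ∈ 𝒜 1) (y : τ → R)

/-- The linear equations of an incidence scheme on a chart. -/
noncomputable def incidenceEq (i : ι) (k : κ) : Γ(ProjProd 𝒜 R, (chart R (hf i)).1) :=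
  ∑ j, pullFst R (hf i) (quot (hf i) (hM i k j)) * pullSnd R (hf i) (y j)

/-- `N i i'` is a transition matrix: dividing `hMN` by `f i * f i'` writes the equations of chart
`i` as combinations of those of chart `i'` on the overlap. -/
lemma res_incidenceEq_mem {N : ι → ι → κ → κ → A} (hN : ∀ i i' k k', N i i' k k' ∈ 𝒜 1)
    (hMN : ∀ i i' k j, M i k j * f i' = ∑ k', N i i' k k' * M i' k' j) (i i' : ι) (k : κ) :
    (ProjProd 𝒜 R).presheaf.map (homOfLE (inf_le_left :
        (chart R (hf i)).1 ⊓ (chart R (hf i')).1 ≤ (chart R (hf i)).1)).op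
          (incidenceEq R hf hM y i k) ∈
      (Ideal.span (Set.range (incidenceEq R hf hM y i'))).map
        ((ProjProd 𝒜 R).presheaf.map (homOfLE (inf_le_right :
          (chart R (hf i)).1 ⊓ (chart R (hf i')).1 ≤ (chart R (hf i')).1)).op).hom := by
  set O := (chart R (hf i)).1 ⊓ (chart R (hf i')).1 with hO
  set r := (ProjProd 𝒜 R).presheaf.map (homOfLE (inf_le_left : O ≤ _)).op
  set r' := (ProjProd 𝒜 R).presheaf.map (homOfLE (inf_le_right : O ≤ _)).op
  -- functions on `D₊(f i * f i')`, pulled back to the overlap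
  have hle : O ≤ projFst 𝒜 R ⁻¹ᵁ Proj.basicOpen 𝒜 (f i * f i') := by
    rw [Proj.basicOpen_mul]
    exact le_rfl
  let p : HomogeneousLocalization.Away 𝒜 (f i * f i') →+* Γ(ProjProd 𝒜 R, O) :=
    (Proj.awayToSection 𝒜 (f i * f i') ≫ (projFst 𝒜 R).appLE _ O hle).hom
  have hp (x : HomogeneousLocalization.Away 𝒜 (f i)) : r (pullFst R (hf i) x) =
      p (HomogeneousLocalization.awayMap 𝒜 (hf i') rfl x) := by
    have := Proj.awayMap_awayToSection 𝒜 (hf i') (rfl : f i * f i' = f i * f i')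
    have h2 : CommRingCat.ofHom (HomogeneousLocalization.awayMap 𝒜 (hf i') rfl) ≫
        Proj.awayToSection 𝒜 (f i * f i') ≫ (projFst 𝒜 R).appLE _ O hle =
        (Proj.awayToSection 𝒜 (f i) ≫ (projFst 𝒜 R).app (Proj.basicOpen 𝒜 (f i))) ≫ r := by
      rw [reassoc_of% this, Scheme.Hom.map_appLE]
      rfl
    exact congr($(h2).hom x).symm
  have hp' (x : HomogeneousLocalization.Away 𝒜 (f i')) : r' (pullFst R (hf i') x) =
      p (HomogeneousLocalization.awayMap 𝒜 (hf i) (mul_comm _ _) x) := by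
    have := Proj.awayMap_awayToSection 𝒜 (hf i) (mul_comm _ _ : f i * f i' = f i' * f i)
    have h2 : CommRingCat.ofHom (HomogeneousLocalization.awayMap 𝒜 (hf i) (mul_comm _ _)) ≫
        Proj.awayToSection 𝒜 (f i * f i') ≫ (projFst 𝒜 R).appLE _ O hle =
        (Proj.awayToSection 𝒜 (f i') ≫ (projFst 𝒜 R).app (Proj.basicOpen 𝒜 (f i'))) ≫ r' := by
      rw [reassoc_of% this, Scheme.Hom.map_appLE]
      rfl
    exact congr($(h2).hom x).symm
  have hs (x : R) : r (pullSnd R (hf i) x) = r' (pullSnd R (hf i') x) := by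
    have h2 : ((Scheme.ΓSpecIso (.of R)).inv ≫
        (projSnd 𝒜 R).appLE ⊤ (chart R (hf i)).1 le_top) ≫ r =
        ((Scheme.ΓSpecIso (.of R)).inv ≫
        (projSnd 𝒜 R).appLE ⊤ (chart R (hf i')).1 le_top) ≫ r' := by
      rw [Category.assoc, Category.assoc]
      exact congrArg _ ((Scheme.Hom.appLE_map _ _ _).trans (Scheme.Hom.appLE_map _ _ _).symm)
    exact congr($(h2).hom x)
  have key : r (incidenceEq R hf hM y i k) = ∑ k', p (HomogeneousLocalization.awayMap 𝒜 (hf i') rfl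
      (quot (hf i) (hN i i' k k'))) * r' (incidenceEq R hf hM y i' k') := by
    simp only [incidenceEq, map_sum, map_mul, hp, hp', hs, Finset.mul_sum]
    rw [Finset.sum_comm]
    refine Finset.sum_congr rfl fun j _ => ?_
    rw [awayMap_quot_eq_sum (hf i) (hf i') (hM i k j) (hN i i' k) (fun k' => hM i' k' j)
      (hMN i i' k j), map_sum, Finset.sum_mul]
    simp only [map_mul, mul_assoc]
  rw [key]
  exact Ideal.sum_mem _ fun k' _ => Ideal.mul_mem_left _ _
    (Ideal.mem_map_of_mem _ (Ideal.subset_span ⟨k', rfl⟩))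

/-- If the equations of an incidence scheme are compatible, then they are its equations on each
chart. -/
lemma incidence_ideal_chart (hcov : ⨆ i, Proj.basicOpen 𝒜 (f i) = ⊤)
    {N : ι → ι → κ → κ → A} (hN : ∀ i i' k k', N i i' k k' ∈ 𝒜 1)
    (hMN : ∀ i i' k j, M i k j * f i' = ∑ k', N i i' k k' * M i' k' j) (i : ι) :
    (incidence R hf hM y).ideal (chart R (hf i)) =
      Ideal.span (Set.range (incidenceEq R hf hM y i)) := by
  refine ideal_sInf_eq_span (fun i => chart R (hf i)) ?_ (incidenceEq R hf hM y)
    (res_incidenceEq_mem R hf hM y hN hMN) i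
  change ⨆ i, projFst 𝒜 R ⁻¹ᵁ Proj.basicOpen 𝒜 (f i) = ⊤
  rw [← Scheme.Hom.preimage_iSup, hcov, Scheme.Hom.preimage_top]

end Incidence

end LogDisc

namespace LogDisc

/-! ### Incidence schemes over affine schemes -/

section Incidence

variable {A : Type} [CommRing A] [Algebra ℂ A] {𝒜 : ℕ → Submodule ℂ A} [GradedAlgebra 𝒜]
variable (R : Type) [CommRing R] [Algebra ℂ R]

lemma awayToSection_awayι_appLE {f : A} (hf : f ∈ 𝒜 1) (e) :
    Proj.awayToSection 𝒜 f ≫ (Proj.awayι 𝒜 f hf one_pos).appLE (Proj.basicOpen 𝒜 f) ⊤ e =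
      (Scheme.ΓSpecIso _).inv := by
  have h1 : (Proj.awayι 𝒜 f hf one_pos).appLE (Proj.basicOpen 𝒜 f) ⊤ e =
      (Proj.basicOpen 𝒜 f).topIso.inv ≫ (Proj.basicOpenIsoSpec 𝒜 f hf one_pos).inv.appTop := by
    have h2 : (Proj.basicOpen 𝒜 f).ι.appLE (Proj.basicOpen 𝒜 f) ⊤ (by simp) =
        (Proj.basicOpen 𝒜 f).topIso.inv := by
      rw [Scheme.Opens.ι_appLE, Scheme.Opens.topIso_inv]
      rfl
    rw [← h2, Scheme.Hom.appTop, ← Scheme.Hom.appLE_eq_app]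
    exact (Scheme.Hom.appLE_comp_appLE _ _ _ _ _ _ _).symm
  have h3 : Proj.awayToSection 𝒜 f ≫ (Proj.basicOpen 𝒜 f).topIso.inv =
      (Scheme.ΓSpecIso _).inv ≫ (Proj.basicOpenToSpec 𝒜 f).appTop := by
    rw [Iso.eq_inv_comp]
    exact (Proj.basicOpenToSpec_app_top 𝒜 f).symm
  rw [h1, ← Category.assoc, h3, Category.assoc, ← Proj.basicOpenIsoSpec_hom 𝒜 f hf one_pos]
  have h4 : (Proj.basicOpenIsoSpec 𝒜 f hf one_pos).hom.appTop ≫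
      (Proj.basicOpenIsoSpec 𝒜 f hf one_pos).inv.appTop = 𝟙 _ := by
    rw [← Scheme.Hom.comp_appTop, Iso.inv_hom_id, Scheme.Hom.id_appTop]
  exact (congrArg _ h4).trans (Category.comp_id _)

variable {S : Scheme.{0}} {t : S ⟶ SpecC} {ψ : S ⟶ Proj 𝒜}

/-- The morphism `S × Spec R ⟶ Proj 𝒜 × Spec R` induced by a morphism `S ⟶ Proj 𝒜`. -/
noncomputable def prodMap (h : ψ ≫ projToSpec 𝒜 = t) :
    pullback t (specToSpec R) ⟶ ProjProd 𝒜 R :=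
  pullback.map _ _ _ _ ψ (𝟙 _) (𝟙 _) (by simp [h]) (by simp)

lemma prodMap_projFst (h : ψ ≫ projToSpec 𝒜 = t) :
    prodMap R h ≫ projFst 𝒜 R = pullback.fst t (specToSpec R) ≫ ψ :=
  pullback.lift_fst _ _ _

lemma prodMap_projSnd (h : ψ ≫ projToSpec 𝒜 = t) :
    prodMap R h ≫ projSnd 𝒜 R = pullback.snd t (specToSpec R) :=
  (pullback.lift_snd _ _ _).trans (Category.comp_id _)

/-- Cancellation of pullbacks: `S × Spec R` and `Proj 𝒜 × Spec R` are both pullbacks of `Spec R`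
over `Spec ℂ`. -/
lemma isPullback_prodMap (h : ψ ≫ projToSpec 𝒜 = t) :
    IsPullback (prodMap R h) (pullback.fst t (specToSpec R)) (projFst 𝒜 R) ψ := by
  refine IsPullback.of_right (h₁₂ := projSnd 𝒜 R) (h₂₂ := projToSpec 𝒜) (v₁₃ := specToSpec R)
    ?_ (prodMap_projFst R h) (IsPullback.of_hasPullback _ _).flip
  rw [prodMap_projSnd, h]
  exact (IsPullback.of_hasPullback _ _).flip

/-- The base change of a family of closed subschemes. -/
lemma isPullback_subscheme (h : ψ ≫ projToSpec 𝒜 = t) (I : (ProjProd 𝒜 R).IdealSheafData)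
    (J : (pullback t (specToSpec R)).IdealSheafData) (hJ : I.comap (prodMap R h) = J) :
    ∃ φ', IsPullback φ' (J.subschemeι ≫ pullback.fst t (specToSpec R))
      (I.subschemeι ≫ projFst 𝒜 R) ψ := by
  subst hJ
  have h1 : IsPullback (Scheme.IdealSheafData.subschemeMap _ I (prodMap R h) (I.le_map_comap _))
      (I.comap (prodMap R h)).subschemeι I.subschemeι (prodMap R h) :=
    (isPullback_of_isClosedImmersion _ _ _ _
      (Scheme.IdealSheafData.subschemeMap_subschemeι _ _ _ _).symm (by simp)).flip
  exact ⟨_, h1.paste_vert (isPullback_prodMap R h)⟩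

section Affine

variable {B : Type} [CommRing B] (t : Spec (.of B) ⟶ SpecC)

/-- Pullback of functions from `Spec B` to `Spec B × Spec R`. -/
noncomputable def affFst : B →+* Γ(pullback t (specToSpec R), ⊤) :=
  ((Scheme.ΓSpecIso (.of B)).inv ≫ (pullback.fst t (specToSpec R)).appTop).hom

/-- Pullback of functions from `Spec R` to `Spec B × Spec R`. -/
noncomputable def affSnd : R →+* Γ(pullback t (specToSpec R), ⊤) :=
  ((Scheme.ΓSpecIso (.of R)).inv ≫ (pullback.snd t (specToSpec R)).appTop).hom

instance : IsAffine (pullback t (specToSpec R)) := by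
  infer_instance

variable {t} {ι κ τ : Type} [Fintype τ] [Fintype κ] {f : ι → A} (hf : ∀ i, f i ∈ 𝒜 1)
    {M : ι → κ → τ → A} (hM : ∀ i k j, M i k j ∈ 𝒜 1) (y : τ → R)

/-- The equations of the pullback of an incidence scheme along a morphism from an affine scheme
to a chart. -/
lemma incidence_comap_ideal_top (hcov : ⨆ i, Proj.basicOpen 𝒜 (f i) = ⊤)
    {N : ι → ι → κ → κ → A} (hN : ∀ i i' k k', N i i' k k' ∈ 𝒜 1)
    (hMN : ∀ i i' k j, M i k j * f i' = ∑ k', N i i' k k' * M i' k' j) (i : ι)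
    (θ : HomogeneousLocalization.Away 𝒜 (f i) →+* B) {ψ : Spec (.of B) ⟶ Proj 𝒜}
    (hψ : ψ = Spec.map (CommRingCat.ofHom θ) ≫ Proj.awayι 𝒜 (f i) (hf i) one_pos)
    (h : ψ ≫ projToSpec 𝒜 = t) :
    ((incidence R hf hM y).comap (prodMap R h)).ideal ⟨⊤, isAffineOpen_top _⟩ =
      Ideal.span (Set.range fun k => ∑ j, affFst R t (θ (quot (hf i) (hM i k j))) *
        affSnd R t (y j)) := by
  have hψD : ⊤ ≤ ψ ⁻¹ᵁ Proj.basicOpen 𝒜 (f i) := by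
    rw [hψ, ← Proj.opensRange_awayι 𝒜 (f i) (hf i) one_pos, Scheme.Hom.comp_preimage,
      Scheme.Hom.preimage_opensRange]
    exact le_rfl
  have e : ⊤ ≤ prodMap R h ⁻¹ᵁ (chart R (hf i)).1 := by
    change ⊤ ≤ prodMap R h ⁻¹ᵁ (projFst 𝒜 R ⁻¹ᵁ Proj.basicOpen 𝒜 (f i))
    rw [← Scheme.Hom.comp_preimage, prodMap_projFst, Scheme.Hom.comp_preimage]
    exact fun x _ => hψD trivial
  -- The chart equations are pulled back generator by generator: functions from `D₊(f i)` pass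
  -- through `θ`, those from `Spec R` are unchanged.
  rw [Scheme.IdealSheafData.ideal_comap _ (prodMap R h) (chart R (hf i)) ⟨⊤, isAffineOpen_top _⟩ e,
    incidence_ideal_chart R hf hM y hcov hN hMN, Ideal.map_span, ← Set.range_comp]
  congr 2
  funext k
  have hfst (z) : (prodMap R h).appLE (chart R (hf i)).1 ⊤ e (pullFst R (hf i) z) =
      affFst R t (θ z) := by
    have h1 : (projFst 𝒜 R).app (Proj.basicOpen 𝒜 (f i)) ≫
        (prodMap R h).appLE (chart R (hf i)).1 ⊤ e =
        ψ.appLE (Proj.basicOpen 𝒜 (f i)) ⊤ hψD ≫ (pullback.fst t (specToSpec R)).appTop := by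
      have key (g : pullback t (specToSpec R) ⟶ Proj 𝒜) (hg : g = pullback.fst _ _ ≫ ψ) (e') :
          g.appLE (Proj.basicOpen 𝒜 (f i)) ⊤ e' =
          ψ.appLE (Proj.basicOpen 𝒜 (f i)) ⊤ hψD ≫ (pullback.fst t (specToSpec R)).appTop := by
        subst hg
        rw [Scheme.Hom.appTop, ← Scheme.Hom.appLE_eq_app]
        exact (Scheme.Hom.appLE_comp_appLE _ _ _ _ _ _ _).symm
      rw [← key _ (prodMap_projFst R h) e, ← Scheme.Hom.appLE_eq_app]
      exact Scheme.Hom.appLE_comp_appLE _ _ _ _ _ _ _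
    have h2 : Proj.awayToSection 𝒜 (f i) ≫ ψ.appLE (Proj.basicOpen 𝒜 (f i)) ⊤ hψD =
        CommRingCat.ofHom θ ≫ (Scheme.ΓSpecIso (.of B)).inv := by
      subst hψ
      rw [Scheme.ΓSpecIso_inv_naturality, ← awayToSection_awayι_appLE (hf i) (by
        rw [← Proj.opensRange_awayι 𝒜 (f i) (hf i) one_pos, Scheme.Hom.preimage_opensRange]),
        Category.assoc, Scheme.Hom.appTop, ← Scheme.Hom.appLE_eq_app]
      exact congrArg _ (Scheme.Hom.appLE_comp_appLE _ _ _ _ _ _ _).symm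
    have h3 : (Proj.awayToSection 𝒜 (f i) ≫ (projFst 𝒜 R).app (Proj.basicOpen 𝒜 (f i))) ≫
        (prodMap R h).appLE (chart R (hf i)).1 ⊤ e = CommRingCat.ofHom θ ≫
        (Scheme.ΓSpecIso (.of B)).inv ≫ (pullback.fst t (specToSpec R)).appTop := by
      refine (Category.assoc _ _ _).trans ((congrArg _ h1).trans ?_)
      rw [reassoc_of% h2]
    exact congr($(h3).hom z)
  have hsnd (z) : (prodMap R h).appLE (chart R (hf i)).1 ⊤ e (pullSnd R (hf i) z) =
      affSnd R t z := by
    have h1 : ((Scheme.ΓSpecIso (.of R)).inv ≫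
        (projSnd 𝒜 R).appLE ⊤ (chart R (hf i)).1 le_top) ≫
        (prodMap R h).appLE (chart R (hf i)).1 ⊤ e =
        (Scheme.ΓSpecIso (.of R)).inv ≫ (pullback.snd t (specToSpec R)).appTop := by
      have key (g : pullback t (specToSpec R) ⟶ Spec (.of R)) (hg : g = pullback.snd _ _) :
          g.appLE ⊤ ⊤ le_top = (pullback.snd t (specToSpec R)).appTop := by
        subst hg
        exact Scheme.Hom.appLE_eq_app _
      rw [Category.assoc, ← key _ (prodMap_projSnd R h)]
      exact congrArg _ (Scheme.Hom.appLE_comp_appLE _ _ _ _ _ _ _)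
    exact congr($(h1).hom z)
  simp only [Function.comp_apply, incidenceEq]
  refine (map_sum _ _ _).trans (Finset.sum_congr rfl fun j _ => ?_)
  refine (map_mul _ _ _).trans ?_
  rw [← hfst, ← hsnd]

end Affine

end Incidence

end LogDisc

namespace LogDisc

/-! ### Morphisms to `Proj` landing in a chart -/

section AwayLift

variable {A : Type} [CommRing A] {σ : Type} [SetLike σ A] [AddSubgroupClass σ A] (𝒜 : ℕ → σ)
  [GradedRing 𝒜]

/-- The map from a degree zero localization away from `r` induced by a ring homomorphism mapping `r`
to a unit. -/
noncomputable def awayLift {B : Type} [CommRing B] (φ : A →+* B) {r : A} (hr : IsUnit (φ r)) :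
    HomogeneousLocalization.Away 𝒜 r →+* B :=
  (Localization.awayLift φ r hr).comp (algebraMap _ (Localization.Away r))

lemma awayLift_mk {B : Type} [CommRing B] (φ : A →+* B) {r : A} (hr : IsUnit (φ r)) {n : ℕ}
    (hn : r ∈ 𝒜 n) (k : ℕ) (a : A) (ha : a ∈ 𝒜 (k • n)) :
    awayLift 𝒜 φ hr (HomogeneousLocalization.Away.mk 𝒜 hn k a ha) * φ r ^ k = φ a := by
  rw [awayLift, RingHom.comp_apply, HomogeneousLocalization.algebraMap_apply,
    HomogeneousLocalization.Away.val_mk, Localization.mk_eq_mk', Localization.awayLift,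
    IsLocalization.Away.lift, ← map_pow]
  refine (congrArg (_ * ·) (IsLocalization.lift_eq (M := Submonoid.powers r)
    (S := Localization (Submonoid.powers r)) (g := φ) ?_ (r ^ k)).symm).trans ?_
  · rintro ⟨_, m, rfl⟩
    simpa using hr.pow m
  · rw [← map_mul]
    exact (congrArg _ (IsLocalization.mk'_spec _ a (⟨r ^ k, k, rfl⟩ : Submonoid.powers r))).trans
      (IsLocalization.lift_eq _ _)

lemma comp_awayLift {B B' : Type} [CommRing B] [CommRing B'] (φ : A →+* B) {r : A}
    (hr : IsUnit (φ r)) (g : B →+* B') :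
    g.comp (awayLift 𝒜 φ hr) = awayLift 𝒜 (g.comp φ) (hr.map g) := by
  rw [awayLift, awayLift, ← RingHom.comp_assoc]
  congr 1
  refine IsLocalization.ringHom_ext (Submonoid.powers r) ?_
  rw [RingHom.comp_assoc, IsLocalization.Away.lift_comp, IsLocalization.Away.lift_comp]

/-- Proportional homogeneous coordinates give the same map: in a fraction `a / r ^ k` the factor `w
^ k` appears in numerator and denominator alike. -/
lemma awayLift_eq_of_smul {B : Type} [CommRing B] (φ ψ : A →+* B) {r : A} (hφ : IsUnit (φ r))
    (hψ : IsUnit (ψ r)) {n : ℕ} (hn : r ∈ 𝒜 n) (w : B)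
    (h : ∀ k, ∀ a ∈ 𝒜 (k • n), φ a = w ^ k * ψ a) : awayLift 𝒜 φ hφ = awayLift 𝒜 ψ hψ := by
  ext x
  obtain ⟨k, a, ha, rfl⟩ := HomogeneousLocalization.Away.mk_surjective 𝒜 hn x
  refine (hφ.pow k).mul_right_cancel ?_
  have hr : φ r = w * ψ r := by simpa using h 1 r (by simpa using hn)
  rw [awayLift_mk, h k a ha, hr, mul_pow, mul_left_comm, awayLift_mk]

/-- If a section `r` of positive degree pulls back to a unit, then the induced morphism to `Proj`
factors through the chart `D₊(r)`. -/
lemma fromOfGlobalSections_eq_of_isUnit {X : Scheme.{0}} (φ : A →+* Γ(X, ⊤))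
    (hφ : (HomogeneousIdeal.irrelevant 𝒜).toIdeal.map φ = ⊤) {r : A} {n : ℕ} (hn : 0 < n)
    (hr : r ∈ 𝒜 n) (hu : IsUnit (φ r)) :
    Proj.fromOfGlobalSections 𝒜 φ hφ =
      X.toSpecΓ ≫ Spec.map (CommRingCat.ofHom (awayLift 𝒜 φ hu)) ≫ Proj.awayι 𝒜 r hr hn := by
  -- Since `φ r` is a unit, the description of the morphism over this basic open describes it on all
  -- of `X`.
  have htop : X.basicOpen (φ r) = ⊤ := X.basicOpen_of_isUnit hu
  have : IsIso (X.basicOpen (φ r)).ι := by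
    rw [htop]
    exact (Scheme.topIso X).isIso_hom
  rw [← cancel_epi (X.basicOpen (φ r)).ι]
  have h := Proj.fromOfGlobalSections_resLE 𝒜 φ hφ hn hr
  rw [← Scheme.Hom.resLE_comp_ι _ (Proj.fromOfGlobalSections_preimage_basicOpen 𝒜 φ hφ hn hr).ge, h,
    Proj.toBasicOpenOfGlobalSections]
  simp only [Category.assoc, Proj.basicOpenIsoSpec_inv_ι]
  rw [Iso.inv_comp_eq, Scheme.isoOfEq_hom_ι_assoc]
  refine Eq.trans ?_ (morphismRestrict_ι_assoc X.toSpecΓ (PrimeSpectrum.basicOpen (φ r)) _)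
  refine congrArg _ ?_
  rw [← Iso.eq_inv_comp, basicOpenIsoSpecAway, IsOpenImmersion.isoOfRangeEq_inv_fac_assoc,
    ← Category.assoc, ← Spec.map_comp, ← CommRingCat.ofHom_comp, awayLift, ← RingHom.comp_assoc]
  congr 4
  refine IsLocalization.ringHom_ext (Submonoid.powers r) ?_
  rw [IsLocalization.map_comp, RingHom.comp_assoc, IsLocalization.Away.lift_comp]

end AwayLift

/-! ### Cramer's rule and the Plücker relations -/

section Cramer

variable {R τ : Type} [CommRing R] {d : ℕ}

/-- Cramer's rule for the system with matrix `M_c` and right-hand side the column `j` of `M`. -/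
lemma det_submatrix_update (M : Matrix (Fin d) τ R) (c : Fin d → τ) (k : Fin d) (j : τ) :
    (M.submatrix id (Function.update c k j)).det = ((M.submatrix id c).adjugate * M) k j := by
  have h : M.submatrix id (Function.update c k j) =
      (M.submatrix id c).updateCol k (fun i => M i j) := by
    ext i l
    by_cases hl : l = k
    · subst hl
      simp
    · simp [hl]
  rw [h, ← Matrix.cramer_apply, Matrix.cramer_eq_adjugate_mulVec]
  rfl

/-- An exchange form of the Plücker relations: the `(k, j)` entry of `adj(M_c) M_{c'} adj(M_{c'}) M
= det(M_{c'}) adj(M_c) M`. -/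
lemma det_submatrix_update_mul (M : Matrix (Fin d) τ R) (c c' : Fin d → τ) (k : Fin d) (j : τ) :
    (M.submatrix id (Function.update c k j)).det * (M.submatrix id c').det =
      ∑ k', (M.submatrix id (Function.update c k (c' k'))).det *
        (M.submatrix id (Function.update c' k' j)).det := by
  simp only [det_submatrix_update]
  have h : (M.submatrix id c).adjugate * M.submatrix id c' * ((M.submatrix id c').adjugate * M) =
      (M.submatrix id c').det • ((M.submatrix id c).adjugate * M) := by
    rw [Matrix.mul_assoc, ← Matrix.mul_assoc (M.submatrix id c'), Matrix.mul_adjugate]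
    simp
  rw [mul_comm]
  exact congr($h k j).symm

lemma span_mulVec_le {κ κ' : Type} [Fintype κ] [Fintype κ'] [Fintype τ] (G : Matrix κ τ R)
    (P : Matrix κ' κ R) (y : τ → R) :
    Ideal.span (Set.range ((P * G).mulVec y)) ≤ Ideal.span (Set.range (G.mulVec y)) := by
  rw [Ideal.span_le]
  rintro _ ⟨i, rfl⟩
  rw [← Matrix.mulVec_mulVec]
  exact Ideal.sum_mem _ fun k _ => Ideal.mul_mem_left _ _ (Ideal.subset_span ⟨k, rfl⟩)

/-- The linear equations `M y = 0` and `(M_c⁻¹ M) y = 0` define the same ideal. -/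
lemma span_mulVec_eq_of_mul_det [Fintype τ] (M G : Matrix (Fin d) τ R) (c : Fin d → τ)
    (hc : IsUnit (M.submatrix id c).det)
    (hG : ∀ k j, G k j * (M.submatrix id c).det = (M.submatrix id (Function.update c k j)).det)
    (y : τ → R) :
    Ideal.span (Set.range (G.mulVec y)) = Ideal.span (Set.range (M.mulVec y)) := by
  have hG' : G = (M.submatrix id c)⁻¹ * M := by
    ext k j
    refine hc.mul_right_cancel ?_
    rw [hG, det_submatrix_update, Matrix.inv_def, Matrix.smul_mul, Matrix.smul_apply, smul_eq_mul,
      mul_right_comm, Ring.inverse_mul_cancel _ hc, one_mul]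
  refine le_antisymm (hG' ▸ span_mulVec_le M _ y) ?_
  have hM : M = M.submatrix id c * G := by
    rw [hG', ← Matrix.mul_assoc, Matrix.mul_nonsing_inv _ hc, Matrix.one_mul]
  conv_lhs => rw [hM]
  exact span_mulVec_le G _ y

end Cramer

/-! ### Evaluation of the generic matrix -/

section MatEval

variable {n d : ℕ} (A : Matrix (Fin (n + 1)) (Fin d) ℂ) {B : Type} [CommRing B] (z : ℂ →+* B)
  (v : Fin (n + 1) → B)

/-- The matrix `Aᵀ diag(v)`. -/
def scaledMatrix : Matrix (Fin d) (Fin (n + 1)) B :=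
  Matrix.of fun k j => z (A j k) * v j

/-- Evaluation of polynomials in the entries of the generic matrix at the matrix `Aᵀ diag(v)`. -/
noncomputable def matEval : MvPolynomial (Fin d × Fin (n + 1)) ℂ →+* B :=
  eval₂Hom z fun p => scaledMatrix A z v p.1 p.2

lemma comp_matEval {B' : Type} [CommRing B'] (g : B →+* B') :
    g.comp (matEval A z v) = matEval A (g.comp z) (g ∘ v) := by
  ext <;> simp [matEval, scaledMatrix]

lemma matEval_minor (c : Fin d → Fin (n + 1)) :
    matEval A z v (minor n d c) = ((scaledMatrix A z v).submatrix id c).det := by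
  rw [minor, RingHom.map_det]
  congr 1
  ext k l
  simp [matEval]

/-- The diagonal matrix contributes one scalar per selected column. Hence only the `d` coordinates
indexed by `c` must be invertible for the minor to be a unit, which is why the charts can exceed the
torus. -/
lemma det_scaledMatrix_submatrix (c : Fin d → Fin (n + 1)) :
    ((scaledMatrix A z v).submatrix id c).det = z (A.submatrix c id).det * ∏ k, v (c k) := by
  rw [← Matrix.det_transpose (A.submatrix c id), RingHom.map_det, mul_comm, ← Matrix.det_mul_row]
  congr 1
  ext k l
  simp [scaledMatrix, mul_comm]

lemma isUnit_matEval_minor {c : Fin d → Fin (n + 1)} (hc : (A.submatrix c id).det ≠ 0)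
    (hv : ∀ k, IsUnit (v (c k))) : IsUnit (matEval A z v (minor n d c)) := by
  rw [matEval_minor, det_scaledMatrix_submatrix]
  exact ((isUnit_iff_ne_zero.mpr hc).map z).mul (IsUnit.prod_univ_iff.mpr hv)

lemma matEval_smul (w : B) {p : MvPolynomial (Fin d × Fin (n + 1)) ℂ} {m : ℕ}
    (hp : p.IsHomogeneous m) : matEval A z (fun j => w * v j) p = w ^ m * matEval A z v p := by
  have h : (fun q : Fin d × Fin (n + 1) => scaledMatrix A z (fun j => w * v j) q.1 q.2) =
      fun q => w * scaledMatrix A z v q.1 q.2 := by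
    ext q
    simp [scaledMatrix, mul_left_comm]
  simp only [matEval, h, coe_eval₂Hom, eval₂_eq', Finset.mul_sum]
  refine Finset.sum_congr rfl fun e he => ?_
  have hm : ∑ i, e i = m := by
    rw [← hp (mem_support_iff.mp he), Finsupp.weight_apply, Finsupp.sum_fintype _ _ (by simp)]
    simp
  simp only [mul_pow, Finset.prod_mul_distrib, Finset.prod_pow_eq_pow_sum, hm]
  ring

end MatEval

section Plucker

variable {n d : ℕ}

/-- The exchange relation for the generic matrix, in the shape of the compatibility hypothesis `hMN`
for the incidence over the Grassmannian. -/
lemma pluckerCoord_update_mul (c c' : Fin d → Fin (n + 1)) (k : Fin d) (j : Fin (n + 1)) :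
    pluckerCoord n d (Function.update c k j) * pluckerCoord n d c' =
      ∑ k', pluckerCoord n d (Function.update c k (c' k')) *
        pluckerCoord n d (Function.update c' k' j) := by
  apply Subtype.ext
  have := det_submatrix_update_mul (Matrix.of fun (k : Fin d) (l : Fin (n + 1)) =>
    (X (k, l) : MvPolynomial (Fin d × Fin (n + 1)) ℂ)) c c' k j
  exact this.trans (by simp [pluckerCoord]; rfl)

lemma iSup_basicOpen_pluckerCoord [NeZero d] :
    ⨆ c, Proj.basicOpen (pluckerGrading n d) (pluckerCoord n d c) = ⊤ := by
  refine Proj.iSup_basicOpen_eq_top' _ _ (fun c => ⟨1, pluckerCoord_mem n d c⟩) ?_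
  have h : Algebra.adjoin ℂ (Set.range (pluckerCoord n d)) = ⊤ := by
    refine Eq.trans (congrArg _ (Set.ext fun x => ?_))
      (Algebra.adjoin_adjoin_coe_preimage (R := ℂ) (s := Set.range (minor n d)))
    exact ⟨fun ⟨c, hc⟩ => ⟨c, congrArg Subtype.val hc⟩, fun ⟨c, hc⟩ => ⟨c, Subtype.ext hc⟩⟩
  -- The covering criterion wants generation over the degree zero part, through which the constants
  -- act.
  refine top_le_iff.mp fun x _ => ?_
  have hx : x ∈ Algebra.adjoin ℂ (Set.range (pluckerCoord n d)) := h ▸ Algebra.mem_top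
  induction hx using Algebra.adjoin_induction with
  | mem x hx => exact Algebra.subset_adjoin hx
  | algebraMap r => exact Subalgebra.algebraMap_mem _ (algebraMap ℂ (pluckerGrading n d 0) r)
  | add x y _ _ hx hy => exact add_mem (hx trivial) (hy trivial)
  | mul x y _ _ hx hy => exact mul_mem (hx trivial) (hy trivial)

lemma iSup_basicOpen_X : ⨆ i : Fin (n + 1), Proj.basicOpen (coordGrading n) (X i) = ⊤ := by
  refine Proj.iSup_basicOpen_eq_top' _ _ (fun i => ⟨1, isHomogeneous_X ℂ i⟩) ?_
  refine top_le_iff.mp fun p _ => ?_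
  induction p using MvPolynomial.induction_on with
  | C r => exact Subalgebra.algebraMap_mem _ (algebraMap ℂ (coordGrading n 0) r)
  | add p q hp hq => exact add_mem (hp trivial) (hq trivial)
  | mul_X p i hp => exact mul_mem (hp trivial) (Algebra.subset_adjoin ⟨i, rfl⟩)

end Plucker

end LogDisc

namespace LogDisc

/-! ### Charts of projective space on which `u ↦ ker (Aᵀ diag(u))` is defined -/

section Const

variable {A : Type} [CommRing A] [Algebra ℂ A] (𝒜 : ℕ → Submodule ℂ A) [GradedAlgebra 𝒜]

/-- The constants in a degree zero localization. -/
noncomputable def awayConst (f : A) : ℂ →+* HomogeneousLocalization.Away 𝒜 f :=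
  (HomogeneousLocalization.fromZeroRingHom 𝒜 (Submonoid.powers f)).comp (algebraMap ℂ (𝒜 0))

lemma awayι_projToSpec {f : A} {m : ℕ} (hf : f ∈ 𝒜 m) (hm : 0 < m) :
    Proj.awayι 𝒜 f hf hm ≫ projToSpec 𝒜 = Spec.map (CommRingCat.ofHom (awayConst 𝒜 f)) := by
  rw [projToSpec, Proj.awayι_toSpecZero_assoc, ← Spec.map_comp, ← CommRingCat.ofHom_comp]
  rfl

lemma awayMap_comp_awayConst {f g x : A} {m : ℕ} (hg : g ∈ 𝒜 m) (hx : x = f * g) :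
    (HomogeneousLocalization.awayMap 𝒜 hg hx).comp (awayConst 𝒜 f) = awayConst 𝒜 x := by
  refine RingHom.ext fun r => ?_
  exact HomogeneousLocalization.awayMap_fromZeroRingHom 𝒜 hg hx _

lemma awayLift_comp_awayConst {B : Type} [CommRing B] (φ : A →+* B) {r : A} (hr : IsUnit (φ r)) :
    (awayLift 𝒜 φ hr).comp (awayConst 𝒜 r) = φ.comp (algebraMap ℂ A) := by
  ext x
  refine Eq.trans ?_ (IsLocalization.Away.lift_eq (S := Localization.Away r) r hr (algebraMap ℂ A x))
  exact congrArg (Localization.awayLift φ r hr) (Localization.mk_one_eq_algebraMap _)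

end Const

section Charts

variable {n d : ℕ}

/-- The monomial `u_{c 0} ⋯ u_{c (d - 1)}`. -/
noncomputable def chartMonomial (c : Fin d → Fin (n + 1)) : MvPolynomial (Fin (n + 1)) ℂ :=
  ∏ k, X (c k)

lemma prod_X_mem_coordGrading {ι : Type} (s : Finset ι) (c : ι → Fin (n + 1)) :
    ∏ k ∈ s, X (c k) ∈ coordGrading n s.card := by
  simpa using IsHomogeneous.prod (R := ℂ) s (fun k => X (c k)) (fun _ => 1)
    (fun k _ => isHomogeneous_X ℂ _)

lemma chartMonomial_mem (c : Fin d → Fin (n + 1)) : chartMonomial c ∈ coordGrading n d := by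
  simpa [chartMonomial] using prod_X_mem_coordGrading Finset.univ c

lemma prod_erase_mem (c : Fin d → Fin (n + 1)) (k : Fin d) :
    ∏ l ∈ Finset.univ.erase k, X (c l) ∈ coordGrading n (d - 1) := by
  simpa using prod_X_mem_coordGrading (Finset.univ.erase k) c

lemma chartMonomial_eq (c : Fin d → Fin (n + 1)) (k : Fin d) :
    chartMonomial c = X (c k) * ∏ l ∈ Finset.univ.erase k, X (c l) :=
  (Finset.mul_prod_erase _ (fun l => X (c l)) (Finset.mem_univ k)).symm

/-- The open subscheme of `ℙⁿ` where no `u_{c k}` vanishes. -/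
noncomputable abbrev chartOpen (c : Fin d → Fin (n + 1)) : (PP n).Opens :=
  Proj.basicOpen (coordGrading n) (chartMonomial c)

/-- The coordinate ring of a chart. -/
abbrev chartRing (c : Fin d → Fin (n + 1)) : Type :=
  HomogeneousLocalization.Away (coordGrading n) (chartMonomial c)

lemma mem_chartOpen {c : Fin d → Fin (n + 1)} {x : PP n} : x ∈ chartOpen c ↔
    ∀ k, x ∈ Proj.basicOpen (coordGrading n) (X (c k)) := by
  have := x.isPrime
  simp only [Proj.mem_basicOpen, chartMonomial, ← HomogeneousIdeal.mem_iff,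
    Ideal.IsPrime.prod_mem_iff]
  simp

lemma torus_le_chartOpen (c : Fin d → Fin (n + 1)) : torus n ≤ chartOpen c := by
  intro x hx
  exact mem_chartOpen.mpr fun k =>
    Proj.basicOpen_mono _ _ _ (Finset.dvd_prod_of_mem _ (Finset.mem_univ (c k))) hx

lemma dense_chartOpen (c : Fin d → Fin (n + 1)) : Dense (chartOpen c : Set (PP n)) :=
  (dense_torus n).mono (torus_le_chartOpen c)

variable [NeZero d] (c : Fin d → Fin (n + 1))

lemma X_mul_prod_erase_mem (j : Fin (n + 1)) (k : Fin d) :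
    X j * ∏ l ∈ Finset.univ.erase k, X (c l) ∈ coordGrading n (1 • d) := by
  have h := (isHomogeneous_X ℂ j).mul (prod_erase_mem c k)
  have hd : 1 + (d - 1) = 1 • d := by
    have := NeZero.pos d
    simp
    omega
  exact hd ▸ h

/-- The coordinate functions `u_j / u_{c 0}` on a chart. -/
noncomputable def chartCoord (j : Fin (n + 1)) : chartRing c :=
  HomogeneousLocalization.Away.mk (coordGrading n) (chartMonomial_mem c) 1
    (X j * ∏ l ∈ Finset.univ.erase 0, X (c l)) (X_mul_prod_erase_mem c j 0)

/-- The inverse of `u_{c k} / u_{c 0}` is `u_{c 0} / u_{c k}`, with both fractions written over the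
chart monomial. -/
lemma isUnit_chartCoord (k : Fin d) : IsUnit (chartCoord c (c k)) := by
  refine IsUnit.of_mul_eq_one (HomogeneousLocalization.Away.mk (coordGrading n)
    (chartMonomial_mem c) 1 (X (c 0) * ∏ l ∈ Finset.univ.erase k, X (c l))
    (X_mul_prod_erase_mem c (c 0) k)) ?_
  apply away_mul_eq_one
  nth_rw 1 [chartMonomial_eq c k]
  rw [chartMonomial_eq c 0]
  ring

/-- The inclusion of a chart into the standard chart `u_{c 0} ≠ 0`. -/
noncomputable def chartToStandard :
    HomogeneousLocalization.Away (coordGrading n) (X (c 0)) →+* chartRing c :=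
  HomogeneousLocalization.awayMap (coordGrading n) (prod_erase_mem c 0) (chartMonomial_eq c 0)

lemma chartToStandard_quot (a : ℂ) (j : Fin (n + 1)) :
    chartToStandard c (quot (isHomogeneous_X ℂ (c 0)) (isHomogeneous_C_mul_X a j)) =
      awayConst (coordGrading n) (chartMonomial c) a * chartCoord c j := by
  rw [awayConst, RingHom.comp_apply, chartCoord, away_const_mul]
  refine (HomogeneousLocalization.awayMap_mk (coordGrading n) _ _ _ _ _ _).trans ?_
  apply HomogeneousLocalization.val_injective
  rw [HomogeneousLocalization.Away.val_mk, HomogeneousLocalization.Away.val_mk]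
  simp [mul_assoc]

/-- The open immersion of a chart. -/
noncomputable abbrev chartι : Spec (.of (chartRing c)) ⟶ PP n :=
  Proj.awayι (coordGrading n) (chartMonomial c) (chartMonomial_mem c) (NeZero.pos d)

lemma chartι_eq : chartι c = Spec.map (CommRingCat.ofHom (chartToStandard c)) ≫
    Proj.awayι (coordGrading n) (X (c 0)) (isHomogeneous_X ℂ (c 0)) one_pos :=
  (Proj.SpecMap_awayMap_awayι (coordGrading n) (isHomogeneous_X ℂ (c 0)) one_pos
    (prod_erase_mem c 0) (chartMonomial_eq c 0)).symm

end Charts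

namespace Arrangement

variable {n d : ℕ} [NeZero d] (𝓐 : Arrangement n d) {c : Fin d → Fin (n + 1)}

/-- Evaluation of the elements of the Plücker algebra at `Aᵀ diag(u) / u_{c 0}`. -/
noncomputable def chartEval (c : Fin d → Fin (n + 1)) : pluckerAlgebra n d →+* chartRing c :=
  (matEval 𝓐.A (awayConst (coordGrading n) (chartMonomial c)) (chartCoord c)).comp
    (pluckerAlgebra n d).val.toRingHom

lemma isUnit_chartEval (hc : (𝓐.A.submatrix c id).det ≠ 0) :
    IsUnit (𝓐.chartEval c (pluckerCoord n d c)) :=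
  isUnit_matEval_minor 𝓐.A _ _ hc (isUnit_chartCoord c)

/-- The pullback of functions under `u ↦ ker (Aᵀ diag(u))`, as a map from a chart of projective
space to a chart of the Grassmannian. -/
noncomputable def chartLift (hc : (𝓐.A.submatrix c id).det ≠ 0) :
    HomogeneousLocalization.Away (pluckerGrading n d) (pluckerCoord n d c) →+* chartRing c :=
  awayLift (pluckerGrading n d) (𝓐.chartEval c) (𝓐.isUnit_chartEval hc)

/-- The morphism `u ↦ ker (Aᵀ diag(u))` on a chart of projective space. -/
noncomputable def chartMap (hc : (𝓐.A.submatrix c id).det ≠ 0) :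
    Spec (.of (chartRing c)) ⟶ Gr n d :=
  Spec.map (CommRingCat.ofHom (𝓐.chartLift hc)) ≫
    Proj.awayι (pluckerGrading n d) (pluckerCoord n d c) (pluckerCoord_mem n d c) one_pos

/-- Compatibility over `ℂ`, needed to form the product of `φ` with the complement via `prodMap`. -/
lemma chartMap_projToSpec (hc : (𝓐.A.submatrix c id).det ≠ 0) :
    𝓐.chartMap hc ≫ projToSpec (pluckerGrading n d) = chartι c ≫ projToSpec (coordGrading n) := by
  rw [chartMap, Category.assoc, awayι_projToSpec, awayι_projToSpec, ← Spec.map_comp,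
    ← CommRingCat.ofHom_comp, chartLift, awayLift_comp_awayConst]
  congr 2
  refine RingHom.ext fun r => ?_
  exact eval₂_C (awayConst (coordGrading n) (chartMonomial c)) _ r

-- The geometric core. With `M = Aᵀ diag(u) / u_{c 0}`, the likelihood equations on the chart are `M
-- γ(x) = 0` and the Hurwitz equations are `M_c⁻¹ M γ(x) = 0`. As `det M_c` is a unit, they generate
-- the same ideal.
set_option maxHeartbeats 800000 in
lemma hurwitzIdeal_comap (hc : (𝓐.A.submatrix c id).det ≠ 0) :
    𝓐.hurwitzIdeal.comap (prodMap 𝓐.coordRing (𝓐.chartMap_projToSpec hc)) =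
      𝓐.likelihoodIdeal.comap (prodMap 𝓐.coordRing (𝒜 := coordGrading n) (ψ := chartι c) rfl) := by
  apply Scheme.IdealSheafData.ext_of_isAffine
  have h1 := incidence_comap_ideal_top 𝓐.coordRing (𝒜 := pluckerGrading n d)
    (pluckerCoord_mem n d) (M := fun c k j => pluckerCoord n d (Function.update c k j))
    (fun _ _ _ => pluckerCoord_mem n d _) 𝓐.recip iSup_basicOpen_pluckerCoord
    (N := fun c c' k k' => pluckerCoord n d (Function.update c k (c' k')))
    (fun _ _ _ _ => pluckerCoord_mem n d _) (fun c c' k j => pluckerCoord_update_mul c c' k j) c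
    (𝓐.chartLift hc) rfl (𝓐.chartMap_projToSpec hc)
  have h2 := incidence_comap_ideal_top 𝓐.coordRing (𝒜 := coordGrading n)
    (f := fun i : Fin (n + 1) => X i) (fun i => isHomogeneous_X ℂ i)
    (M := fun (_ : Fin (n + 1)) (k : Fin d) (j : Fin (n + 1)) => C (𝓐.A j k) * X j)
    (fun _ k j => isHomogeneous_C_mul_X (𝓐.A j k) j) 𝓐.recip iSup_basicOpen_X
    -- The numerators do not depend on the standard chart, so the transition matrix is `u_{i'}`
    -- times the identity.
    (N := fun i i' k k' => if k = k' then X i' else 0)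
    (fun i i' k k' => by
      split_ifs
      · exact isHomogeneous_X ℂ i'
      · exact zero_mem _)
    (fun i i' k j => by simp [mul_comm]) (c 0) (chartToStandard c) (chartι_eq c) rfl
  refine h1.trans (Eq.trans ?_ h2.symm)
  let α := affFst 𝓐.coordRing (chartι c ≫ projToSpec (coordGrading n))
  let M := scaledMatrix 𝓐.A (α.comp (awayConst (coordGrading n) (chartMonomial c)))
    (α ∘ chartCoord c)
  have hM (c') : (M.submatrix id c').det = α (𝓐.chartEval c (pluckerCoord n d c')) := by
    refine Eq.trans ?_ (congr($(comp_matEval 𝓐.A _ _ α) (minor n d c'))).symm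
    exact (matEval_minor _ _ _ _).symm
  have key := span_mulVec_eq_of_mul_det M (Matrix.of fun k j => α (𝓐.chartLift hc
    (quot (pluckerCoord_mem n d c) (pluckerCoord_mem n d (Function.update c k j))))) c
    (by rw [hM]; exact (𝓐.isUnit_chartEval hc).map α) (fun k j => by
      rw [hM, hM, Matrix.of_apply, ← map_mul]
      congr 1
      have := awayLift_mk (pluckerGrading n d) (𝓐.chartEval c) (𝓐.isUnit_chartEval hc)
        (pluckerCoord_mem n d c) 1 _ (pluckerCoord_mem n d (Function.update c k j))
      rwa [pow_one] at this)
    (fun j => affSnd 𝓐.coordRing (chartι c ≫ projToSpec (coordGrading n)) (𝓐.recip j))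
  refine key.trans ?_
  congr 2
  funext k
  refine congrArg (Finset.sum (Finset.univ : Finset (Fin (n + 1)))) (funext fun j => ?_)
  change α (awayConst (coordGrading n) (chartMonomial c) (𝓐.A j k)) * α (chartCoord c j) * _ = _
  refine congrArg (· * _) ?_
  rw [chartToStandard_quot]
  exact (map_mul _ _ _).symm

end Arrangement

end LogDisc

/-! ### The Hurwitz closure and the representatives of `φ` on charts -/

namespace LogDisc

/-- The closure of the pullback of a closed subscheme along a partial map restricts to a subscheme
of its pullback along restrictions of the partial map. -/
lemma comap_map_comap_le_of_homOfLE_comp {X Y S : Scheme.{0}} (J : Y.IdealSheafData)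
    {f g : X.PartialMap Y} (h : f.domain ≤ g.domain) (hfg : X.homOfLE h ≫ g.hom = f.hom)
    (p : S ⟶ f.domain.toScheme) :
    ((J.comap g.hom).map g.domain.ι).comap (p ≫ f.domain.ι) ≤ J.comap (p ≫ f.hom) := by
  have h₁ : (p ≫ X.homOfLE h) ≫ g.domain.ι = p ≫ f.domain.ι := by
    rw [Category.assoc, X.homOfLE_ι]
  have h₂ : (p ≫ X.homOfLE h) ≫ g.hom = p ≫ f.hom := by
    rw [Category.assoc, hfg]
  rw [← h₁, ← h₂, Scheme.IdealSheafData.comap_comp J (p ≫ X.homOfLE h) g.hom,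
    Scheme.IdealSheafData.comap_comp _ (p ≫ X.homOfLE h) g.domain.ι]
  exact Scheme.IdealSheafData.comap_mono _ (Scheme.IdealSheafData.comap_map_le _ _)

/-- For a reduced source and a separated target, every representative of a rational map is a
restriction of the one on the maximal domain. -/
lemma comap_map_comap_toPartialMap_le {X Y S : Scheme.{0}} [IsReduced X] [Y.IsSeparated]
    (J : Y.IdealSheafData) {r : X.RationalMap Y} {f : X.PartialMap Y} (hf : r = f.toRationalMap)
    (p : S ⟶ f.domain.toScheme) :
    ((J.comap r.toPartialMap.hom).map r.toPartialMap.domain.ι).comap (p ≫ f.domain.ι) ≤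
      J.comap (p ≫ f.hom) := by
  subst hf
  exact comap_map_comap_le_of_homOfLE_comp J (g := f.toRationalMap.toPartialMap)
    f.le_domain_toRationalMap f.toPartialMap_toRationalMap_restrict p

/-- A morphism from a basic open of a projective spectrum to a projective spectrum that is given by
global sections and lands in a chart. -/
lemma fromOfGlobalSections_basicOpen {A A' : Type} [CommRing A] [CommRing A'] {σ σ' : Type}
    [SetLike σ A] [AddSubgroupClass σ A] [SetLike σ' A'] [AddSubgroupClass σ' A'] (𝒜 : ℕ → σ)
    (𝒜' : ℕ → σ') [GradedRing 𝒜] [GradedRing 𝒜'] {f : A'}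
    (φ : A →+* HomogeneousLocalization.Away 𝒜' f)
    {χ : A →+* Γ((Proj.basicOpen 𝒜' f).toScheme, ⊤)}
    (hχ : (HomogeneousIdeal.irrelevant 𝒜).toIdeal.map χ = ⊤)
    (h : χ = (Proj.awayToSection 𝒜' f ≫ (Proj.basicOpen 𝒜' f).topIso.inv).hom.comp φ)
    {r : A} {n : ℕ} (hn : 0 < n) (hr : r ∈ 𝒜 n) (hu : IsUnit (φ r)) :
    Proj.fromOfGlobalSections 𝒜 χ hχ = Proj.basicOpenToSpec 𝒜' f ≫
      Spec.map (CommRingCat.ofHom (awayLift 𝒜 φ hu)) ≫ Proj.awayι 𝒜 r hr hn := by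
  subst h
  rw [fromOfGlobalSections_eq_of_isUnit 𝒜 _ hχ hn hr
      (hu.map (Proj.awayToSection 𝒜' f ≫ (Proj.basicOpen 𝒜' f).topIso.inv).hom), ← comp_awayLift 𝒜 φ hu,
    CommRingCat.ofHom_comp, CommRingCat.ofHom_hom, Spec.map_comp, Spec.map_comp,
    Proj.basicOpenToSpec, Scheme.Opens.toSpecΓ]
  simp only [Category.assoc]

namespace Arrangement

variable {n d : ℕ} (𝓐 : Arrangement n d)

instance : Algebra.FiniteType ℂ 𝓐.coordRing := by
  have h : Algebra.FiniteType (MvPolynomial (Fin d) ℂ) 𝓐.coordRing :=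
    IsLocalization.finiteType_of_monoid_fg (Submonoid.powers (∏ i, 𝓐.ell i)) _
  exact Algebra.FiniteType.trans (S := MvPolynomial (Fin d) ℂ) inferInstance h

instance {A : Type} [CommRing A] [Algebra ℂ A] (𝒜 : ℕ → Submodule ℂ A) [GradedAlgebra 𝒜] :
    LocallyOfFiniteType (projFst 𝒜 𝓐.coordRing) := by
  have h : LocallyOfFiniteType (specToSpec 𝓐.coordRing) := by
    rw [specToSpec, HasRingHomProperty.Spec_iff (P := @LocallyOfFiniteType)]
    exact RingHom.finiteType_algebraMap.mpr inferInstance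
  have : MorphismProperty.IsStableUnderBaseChange @LocallyOfFiniteType.{0} := inferInstance
  exact this.of_isPullback (IsPullback.of_hasPullback (projToSpec 𝒜) (specToSpec _)).flip h

instance : LocallyOfFiniteType 𝓐.likelihoodProj := by
  unfold likelihoodProj
  infer_instance

instance : QuasiCompact 𝓐.likelihoodProj := by
  unfold likelihoodProj
  infer_instance

/-! ### The rational map on a chart -/

/-- The coordinate functions `u_j / u_0` on the torus. -/
noncomputable def torusCoord (n : ℕ) (j : Fin (n + 1)) :
    HomogeneousLocalization.Away (coordGrading n) (∏ i, X i) :=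
  HomogeneousLocalization.Away.mk (coordGrading n) (prod_X_mem n) 1
    (X j * ∏ i : Fin n, X i.succ) (by
      have h := (isHomogeneous_X ℂ j).mul (prod_X_mem_coordGrading Finset.univ (Fin.succ (n := n)))
      simpa [add_comm] using h)

lemma torusEntry_eq_mul_torusCoord (k : Fin d) (j : Fin (n + 1)) :
    𝓐.torusEntry k j = awayConst (coordGrading n) _ (𝓐.A j k) * torusCoord n j := by
  rw [awayConst, RingHom.comp_apply, torusCoord, away_const_mul, torusEntry]
  congr 1
  simp only [algebraMap_eq, mul_assoc]

lemma isUnit_torusCoord (j : Fin (n + 1)) : IsUnit (torusCoord n j) := by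
  refine IsUnit.of_mul_eq_one (HomogeneousLocalization.Away.mk (coordGrading n)
    (prod_X_mem n) 1 (X 0 * ∏ i ∈ Finset.univ.erase j, X i) (by
      have h := (isHomogeneous_X ℂ 0).mul
        (prod_X_mem_coordGrading (Finset.univ.erase j) (id : Fin (n + 1) → _))
      simpa [add_comm] using h)) ?_
  apply away_mul_eq_one
  nth_rw 1 [Fin.prod_univ_succ]
  rw [← Finset.mul_prod_erase Finset.univ _ (Finset.mem_univ j)]
  ring

/-- Evaluation of the elements of the Plücker algebra at `Aᵀ diag(u) / u₀`. -/
noncomputable def torusPluckerEval : pluckerAlgebra n d →+*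
    HomogeneousLocalization.Away (coordGrading n) (∏ i, X i) :=
  (matEval 𝓐.A (awayConst (coordGrading n) (∏ i, X i)) (torusCoord n)).comp
    (pluckerAlgebra n d).val.toRingHom

lemma torusEval_comp_val : 𝓐.torusEval.comp (pluckerAlgebra n d).val.toRingHom =
    (Proj.awayToSection (coordGrading n) (∏ i, X i) ≫ (torus n).topIso.inv).hom.comp
      𝓐.torusPluckerEval := by
  have h : (fun p : Fin d × Fin (n + 1) => 𝓐.torusEntry p.1 p.2) =
      fun p => scaledMatrix 𝓐.A (awayConst (coordGrading n) _) (torusCoord n) p.1 p.2 :=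
    funext fun p => 𝓐.torusEntry_eq_mul_torusCoord p.1 p.2
  rw [torusEval, h]
  rfl

variable {c : Fin d → Fin (n + 1)}

lemma isUnit_torusPluckerEval (hc : (𝓐.A.submatrix c id).det ≠ 0) : IsUnit (𝓐.torusPluckerEval (pluckerCoord n d c)) :=
  isUnit_matEval_minor 𝓐.A _ _ hc fun _ => isUnit_torusCoord _

variable [NeZero d]

instance : LocallyOfFiniteType 𝓐.hurwitzProj := by
  unfold hurwitzProj
  infer_instance

lemma torusMap_eq (hc : (𝓐.A.submatrix c id).det ≠ 0) : 𝓐.torusMap = Proj.basicOpenToSpec (coordGrading n) (∏ i, X i) ≫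
    Spec.map (CommRingCat.ofHom
      (awayLift (pluckerGrading n d) 𝓐.torusPluckerEval (𝓐.isUnit_torusPluckerEval hc))) ≫
    Proj.awayι (pluckerGrading n d) (pluckerCoord n d c) (pluckerCoord_mem n d c) one_pos :=
  fromOfGlobalSections_basicOpen (pluckerGrading n d) (coordGrading n) 𝓐.torusPluckerEval
    𝓐.torusEval_irrelevant 𝓐.torusEval_comp_val one_pos (pluckerCoord_mem n d c)
    (𝓐.isUnit_torusPluckerEval hc)

/-- The torus normalises by `u₀` and the chart by `u_{c 0}`; on the overlap the coordinates differ
by the common factor `u_{c 0} / u₀`. -/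
lemma awayMap_torusCoord (j : Fin (n + 1)) :
    HomogeneousLocalization.awayMap (coordGrading n) (chartMonomial_mem c)
      (mul_comm (chartMonomial c) (∏ i, X i)) (torusCoord n j) =
    HomogeneousLocalization.awayMap (coordGrading n) (chartMonomial_mem c)
      (mul_comm (chartMonomial c) (∏ i, X i)) (torusCoord n (c 0)) *
    HomogeneousLocalization.awayMap (coordGrading n) (prod_X_mem n)
      (rfl : chartMonomial c * ∏ i, X i = _) (chartCoord c j) := by
  apply HomogeneousLocalization.val_injective
  rw [HomogeneousLocalization.val_mul]
  simp only [torusCoord, chartCoord, HomogeneousLocalization.awayMap_mk,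
    HomogeneousLocalization.Away.val_mk, Localization.mk_mul]
  rw [Localization.mk_eq_mk_iff, Localization.r_iff_exists]
  refine ⟨1, ?_⟩
  have h := chartMonomial_eq c 0
  simp only [OneMemClass.coe_one, Submonoid.coe_mul, pow_one, one_mul]
  linear_combination (chartMonomial c * (∏ i, X i) * (∏ i : Fin n, X i.succ) * X j *
    chartMonomial c * (∏ i, X i)) * h

/-- The evaluations on the torus and on a chart differ by rescaling. -/
lemma awayMap_comp_awayLift (hc : (𝓐.A.submatrix c id).det ≠ 0) :
    (HomogeneousLocalization.awayMap (coordGrading n) (chartMonomial_mem c)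
      (mul_comm (chartMonomial c) (∏ i, X i))).comp
        (awayLift (pluckerGrading n d) 𝓐.torusPluckerEval (𝓐.isUnit_torusPluckerEval hc)) =
    (HomogeneousLocalization.awayMap (coordGrading n) (prod_X_mem n)
      (rfl : chartMonomial c * ∏ i, X i = _)).comp (𝓐.chartLift hc) := by
  rw [chartLift, comp_awayLift, comp_awayLift]
  -- Plücker degree `k` is polynomial degree `d * k` in the matrix entries, so the scaling factor
  -- per Plücker degree is `(u_{c 0} / u₀) ^ d`.
  refine awayLift_eq_of_smul (pluckerGrading n d) _ _ _ _ (pluckerCoord_mem n d c)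
    (HomogeneousLocalization.awayMap (coordGrading n) (chartMonomial_mem c)
      (mul_comm (chartMonomial c) (∏ i, X i)) (torusCoord n (c 0)) ^ d) fun k a ha => ?_
  rw [torusPluckerEval, chartEval, ← RingHom.comp_assoc, ← RingHom.comp_assoc, comp_matEval,
    comp_matEval, awayMap_comp_awayConst, awayMap_comp_awayConst, ← pow_mul]
  have ha' : (a : MvPolynomial (Fin d × Fin (n + 1)) ℂ).IsHomogeneous (d * k) := by
    simpa [pluckerGrading] using ha
  refine Eq.trans ?_ (matEval_smul 𝓐.A _ _ _ ha')
  exact congr(matEval 𝓐.A _ $(_root_.funext fun j => awayMap_torusCoord j) _)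

/-- The two partial maps agree on the dense torus, which lies inside the chart. Consequently the
whole chart belongs to the maximal domain of `φ`. -/
lemma ratMap_eq (hc : (𝓐.A.submatrix c id).det ≠ 0) : 𝓐.ratMap = Scheme.PartialMap.toRationalMap ⟨chartOpen c, dense_chartOpen c,
    Proj.basicOpenToSpec (coordGrading n) (chartMonomial c) ≫ 𝓐.chartMap hc⟩ := by
  rw [ratMap, Scheme.PartialMap.toRationalMap_eq_iff]
  have hle : Proj.basicOpen (coordGrading n) (chartMonomial c * ∏ i, X i) ≤ torus n :=
    Proj.basicOpen_mono _ _ _ (dvd_mul_left _ _)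
  have hle' : Proj.basicOpen (coordGrading n) (chartMonomial c * ∏ i, X i) ≤ chartOpen c :=
    Proj.basicOpen_mono _ _ _ (dvd_mul_right _ _)
  have hW : torus n ≤ Proj.basicOpen (coordGrading n) (chartMonomial c * ∏ i, X i) := by
    rw [Proj.basicOpen_mul]
    exact le_inf (torus_le_chartOpen c) le_rfl
  refine ⟨_, (dense_torus n).mono hW, hle, hle', ?_⟩
  change (PP n).homOfLE hle ≫ 𝓐.torusMap = (PP n).homOfLE hle' ≫ _ ≫ _
  refine (congrArg _ (𝓐.torusMap_eq hc)).trans ?_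
  have h1 := Proj.basicOpenToSpec_SpecMap_awayMap (coordGrading n) (chartMonomial_mem c)
    (mul_comm (chartMonomial c) (∏ i, X i))
  have h2 := Proj.basicOpenToSpec_SpecMap_awayMap (coordGrading n) (prod_X_mem n)
    (rfl : chartMonomial c * ∏ i, X i = _)
  have h3 := congr(Spec.map (CommRingCat.ofHom $(𝓐.awayMap_comp_awayLift hc)))
  rw [CommRingCat.ofHom_comp, CommRingCat.ofHom_comp, Spec.map_comp, Spec.map_comp] at h3
  exact ((reassoc_of% h1) _).symm.trans
    ((congrArg _ ((reassoc_of% h3) _)).trans ((reassoc_of% h2) _))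

/-! ### Comparison of the discriminants on a chart -/

lemma nablaHu_comap_le (hc : (𝓐.A.submatrix c id).det ≠ 0) :
    𝓐.nablaHu.comap (chartι c) ≤ 𝓐.associatedHypersurface.comap (𝓐.chartMap hc) := by
  refine (comap_map_comap_toPartialMap_le 𝓐.associatedHypersurface (𝓐.ratMap_eq hc)
    (Proj.basicOpenIsoSpec (coordGrading n) (chartMonomial c) (chartMonomial_mem c)
      (NeZero.pos d)).inv).trans_eq (congrArg _ ?_)
  rw [Iso.inv_comp_eq]
  rfl

/-- Over the chart, the base changes of both projections are the same morphism. Its branch scheme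
lies in the pullback of the associated hypersurface, and equals the restriction of `∇_log` because
`chartι c` is an open immersion. -/
lemma nablaHu_comap_chartι_le (hc : (𝓐.A.submatrix c id).det ≠ 0) : 𝓐.nablaHu.comap (chartι c) ≤ 𝓐.nablaLog.comap (chartι c) := by
  refine (𝓐.nablaHu_comap_le hc).trans ?_
  -- The ideal left as `_` is the pulled back likelihood ideal, so that both squares share one
  -- left-hand morphism.
  obtain ⟨φ₁, h₁⟩ := isPullback_subscheme 𝓐.coordRing (𝓐.chartMap_projToSpec hc) 𝓐.hurwitzIdeal
    _ (𝓐.hurwitzIdeal_comap hc)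
  obtain ⟨φ₂, h₂⟩ := isPullback_subscheme 𝓐.coordRing (𝒜 := coordGrading n) (ψ := chartι c) rfl
    𝓐.likelihoodIdeal _ rfl
  exact (branch_comap_le_of_isPullback (f := 𝓐.hurwitzProj) h₁).trans
    (branch_of_isPullback_of_isOpenImmersion (f := 𝓐.likelihoodProj) h₂).le

end Arrangement

end LogDisc

namespace AlgebraicGeometry.Scheme.IdealSheafData

/-! ### Comparison of ideal sheaves is local -/

lemma le_of_comap_le {X : Scheme.{0}} {I J : X.IdealSheafData} {ι : Type} {S : ι → Scheme.{0}}
    (p : ∀ i, S i ⟶ X) [∀ i, IsOpenImmersion (p i)] (hp : ⨆ i, (p i).opensRange = ⊤)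
    (h : ∀ i, I.comap (p i) ≤ J.comap (p i)) : I ≤ J := by
  refine le_of_iSup_eq_top (fun q : Σ i, (S i).affineOpens =>
    (⟨p q.1 ''ᵁ q.2.1, q.2.2.image_of_isOpenImmersion _⟩ : X.affineOpens)) ?_ fun ⟨i, W⟩ => ?_
  · refine top_le_iff.mp (hp.ge.trans (iSup_le fun i => ?_))
    rintro _ ⟨x, rfl⟩
    obtain ⟨W, hW, hxW, -⟩ := (S i).isBasis_affineOpens.exists_subset_of_mem_open
      (Set.mem_univ x) isOpen_univ
    obtain ⟨W, hW, rfl⟩ := hW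
    exact Opens.mem_iSup.mpr ⟨⟨i, ⟨W, hW⟩⟩, x, hxW, rfl⟩
  · have hW := h i W
    rw [ideal_comap_of_isOpenImmersion, ideal_comap_of_isOpenImmersion] at hW
    have e : Function.Surjective ((p i).appIso W).inv.hom :=
      ((p i).appIso W).symm.commRingCatIsoToRingEquiv.surjective
    exact (Ideal.comap_le_comap_iff_of_surjective _ e _ _).mp hW

/-- The traces of the images on `D` cover `D`, and the inclusion of each trace factors through the
corresponding `p i`. -/
lemma comap_ι_le_of_le_iSup {X : Scheme.{0}} {I J : X.IdealSheafData} {ι : Type}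
    {S : ι → Scheme.{0}} (p : ∀ i, S i ⟶ X) [∀ i, IsOpenImmersion (p i)] (D : X.Opens)
    (hD : D ≤ ⨆ i, (p i).opensRange) (h : ∀ i, I.comap (p i) ≤ J.comap (p i)) :
    I.comap D.ι ≤ J.comap D.ι := by
  refine le_of_comap_le (fun i => (D.ι ⁻¹ᵁ (p i).opensRange).ι) ?_ fun i => ?_
  · simp only [Scheme.Opens.opensRange_ι]
    rw [← Scheme.Hom.preimage_iSup]
    exact top_le_iff.mp fun x _ => hD x.2
  · have hr : Set.range ((D.ι ⁻¹ᵁ (p i).opensRange).ι ≫ D.ι) ⊆ Set.range (p i) := by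
      rintro _ ⟨x, rfl⟩
      exact x.2
    rw [← comap_comp, ← comap_comp, ← IsOpenImmersion.lift_fac (p i) _ hr, comap_comp, comap_comp]
    exact comap_mono _ (h i)

end AlgebraicGeometry.Scheme.IdealSheafData

/-! ### Covering the torus and `D` by charts -/

namespace LogDisc

lemma exists_det_submatrix_ne_zero {K τ : Type} [Field K] [Fintype τ] {d : ℕ}
    (M : Matrix τ (Fin d) K) (hM : M.rank = d) :
    ∃ c : Fin d → τ, (M.submatrix c id).det ≠ 0 := by
  rw [Matrix.rank_eq_finrank_span_row] at hM
  obtain ⟨g, hg, -, hli⟩ := Submodule.exists_fun_fin_finrank_span_eq K (Set.range M.row)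
  choose c hc using hg
  refine ⟨fun k => c (Fin.cast hM.symm k), ?_⟩
  have hli' : LinearIndependent K (M.submatrix (fun k => c (Fin.cast hM.symm k)) id).row := by
    have e : (M.submatrix (fun k => c (Fin.cast hM.symm k)) id).row = g ∘ Fin.cast hM.symm := by
      ext k l
      exact congrFun (hc _) l
    rw [e]
    exact hli.comp (Fin.cast hM.symm) (Fin.cast_injective _)
  rw [Matrix.linearIndependent_rows_iff_isUnit, Matrix.isUnit_iff_isUnit_det] at hli'
  exact hli'.ne_zero

namespace Arrangement

variable {n d : ℕ} (𝓐 : Arrangement n d)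

/-- At a point of `D` at most one coordinate vanishes. If it is `uᵢ`, a non-zero minor of `Aⁱ` uses
only coordinates that do not vanish; if there is none, any non-zero minor works. -/
lemma exists_mem_chartOpen_of_mem_domD
    (h : ∀ i : Fin (n + 1), (𝓐.A.submatrix i.succAbove id).rank = d) {x : PP n}
    (hx : x ∈ domD n) :
    ∃ c : Fin d → Fin (n + 1), (𝓐.A.submatrix c id).det ≠ 0 ∧ x ∈ chartOpen c := by
  by_cases hi : ∃ i : Fin (n + 1), x ∉ Proj.basicOpen (coordGrading n) (X i)
  · obtain ⟨i, hi⟩ := hi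
    obtain ⟨c, hc⟩ := exists_det_submatrix_ne_zero _ (h i)
    refine ⟨i.succAbove ∘ c, hc, mem_chartOpen.mpr fun k => ?_⟩
    have hd (j j' : Fin (n + 1)) (hj : j < j') : x ∈ Proj.basicOpen (coordGrading n) (X j) ⊔
        Proj.basicOpen (coordGrading n) (X j') :=
      (iInf_le_of_le j (iInf_le_of_le j' (iInf_le _ hj)) : domD n ≤ _) hx
    rcases lt_or_gt_of_ne (i.succAbove_ne (c k)) with hlt | hlt
    · exact (hd _ _ hlt).resolve_right hi
    · exact (hd _ _ hlt).resolve_left hi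
  · push Not at hi
    obtain ⟨c, hc⟩ := 𝓐.exists_det_ne_zero
    exact ⟨c, hc, mem_chartOpen.mpr fun k => hi _⟩

variable [NeZero d]

lemma nablaHu_comap_ι_le (D : (PP n).Opens)
    (hD : ∀ x ∈ D, ∃ c : Fin d → Fin (n + 1), (𝓐.A.submatrix c id).det ≠ 0 ∧ x ∈ chartOpen c) :
    𝓐.nablaHu.comap D.ι ≤ 𝓐.nablaLog.comap D.ι := by
  refine Scheme.IdealSheafData.comap_ι_le_of_le_iSup
    (fun c : {c : Fin d → Fin (n + 1) // (𝓐.A.submatrix c id).det ≠ 0} => chartι c.1) D ?_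
    fun c => 𝓐.nablaHu_comap_chartι_le c.2
  intro x hx
  obtain ⟨c, hc, hxc⟩ := hD x hx
  refine Opens.mem_iSup.mpr ⟨⟨c, hc⟩, ?_⟩
  rwa [Proj.opensRange_awayι]

end Arrangement

end LogDisc

theorem proposition3p3 {n d : ℕ} [NeZero d] (𝓐 : LogDisc.Arrangement n d) :
    𝓐.nablaHu.comap (LogDisc.torus n).ι ≤ 𝓐.nablaLog.comap (LogDisc.torus n).ι ∧
    ((∀ i : Fin (n + 1), (𝓐.A.submatrix i.succAbove id).rank = d) →
      𝓐.nablaHu.comap (LogDisc.domD n).ι ≤ 𝓐.nablaLog.comap (LogDisc.domD n).ι) ∧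
    (∀ {X Y X' Y' : Scheme.{0}} (f : X ⟶ Y) (f' : X' ⟶ Y') (φ : Y' ⟶ Y) (φ' : X' ⟶ X)
      [LocallyOfFiniteType f], IsPullback φ' f' f φ →
      LogDisc.ram f' = (LogDisc.ram f).comap φ' ∧
      (LogDisc.branch f).comap φ ≤ LogDisc.branch f') := by
  refine ⟨𝓐.nablaHu_comap_ι_le _ fun x hx => ?_, fun h => 𝓐.nablaHu_comap_ι_le _ fun x hx =>
    𝓐.exists_mem_chartOpen_of_mem_domD h hx, fun f f' φ φ' _ h =>
    ⟨LogDisc.ram_of_isPullback h, LogDisc.branch_comap_le_of_isPullback h⟩⟩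
  -- Any non-zero maximal minor of `A` suffices, since its chart contains the torus.
  obtain ⟨c, hc⟩ := 𝓐.exists_det_ne_zero
  exact ⟨c, hc, LogDisc.torus_le_chartOpen c hx⟩
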